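/- Let $\mathbb T=\mathbb R/\mathbb Z$ and, for a distribution $f$ on $\mathbb T$, let $\hat f(\xi)$, $\xi\in\mathbb Z$, be its Fourier coefficients, $\hat f(\xi)=\int_{\mathbb T} f(x)e^{-2\pi i\xi x}\,dx$. Fix a smooth even function $\varphi:\mathbb R\to[0,1]$ with support in $\{6/7\le|\xi|\le 2\}$, with $\varphi(\xi)=1$ for $1\le|\xi|\le 12/7$, with $\sum_{j\ge 0}\varphi(2^{-j}\xi)=1$ for all $|\xi|\ge 1$, and such that $\varphi(2^{-j}\cdot)$ and $\varphi(2^{-j'}\cdot)$ have disjoint supports whenever $|j-j'|\ge 2$ (such functions exist). For $j\ge 0$ put $\mathbb P_{2^j}f(x)=\sum_{\xi\in\mathbb Z}\hat f(\xi)\varphi(2^{-j}\xi)e^{2\pi i\xi x}$, and let $\mathbb P_{\neq 0}f=f-\hat f(0)$. For $s,\alpha\in\mathbb R$ let $$\|f\|_{\dot H^s}=\Big(\sum_{\xi\neq 0}|\xi|^{2s}|\hat f(\xi)|^2\Big)^{1/2},\qquad \|f\|_{\dot B^{\alpha}_{\infty,\infty}}=\sup_{j\ge 0}2^{j\alpha}\|\mathbb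 P_{2^j}f\|_{L^\infty(\mathbb T)},$$ and let $\dot H^s(\mathbb T)$ and $\dot B^\alpha_{\infty,\infty}(\mathbb T)$ be the sets of distributions for which these quantities are finite. For distributions $f,g$, say that $\mathbb P_{\neq 0}(fg)$ exists as a paraproduct in $\dot H^s(\mathbb T)$ if $$\sum_{j,j'\ge 0}\big\|\mathbb P_{\neq 0}\big(\mathbb P_{2^j}(f)\,\mathbb P_{2^{j'}}(g)\big)\big\|_{\dot H^s}<\infty,$$ and then define $\mathbb P_{\neq 0}(fg)=\sum_{j,j'\ge 0}\mathbb P_{\neq 0}(\mathbb P_{2^j}(f)\,\mathbb P_{2^{j'}}(g))$, the sum being taken in $\dot H^s(\mathbb T)$ (with mean zero). If $u\in\dot H^{s}(\mathbb T)$ for some $s<0$, say that $u$ is a weak paraproduct solution of the stationary KdV equation $6uu'-u'''=0$ if there is $s'\in\mathbb R$ such that $\mathbb P_{\neq 0}(u^2)$ exists as a paraproduct in $\dot H^{s'}(\mathbb T)$ and $$-\langle u,\psi'''\rangle+3\langle\mathbb P_{\neq 0}(u^2),\psi'\rangle=0\qquad\text{for all }\psi\in C^\infty(\mathbb T),$$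 where $\langle f,\psi\rangle=\sum_{\xi}\hat f(\xi)\hat\psi(-\xi)$ is the bilinear duality pairing. **Theorem (Flexibility).** There is a real-valued function $$u\in\bigcap_{0<\epsilon<1}\left(\dot B^{-\epsilon}_{\infty,\infty}(\mathbb T)\cap L^{2-\epsilon}(\mathbb T)\right)\setminus L^2(\mathbb T)$$ such that (a) $\mathbb P_{\neq 0}(u^2)$ exists as a paraproduct in $\dot H^{-s}(\mathbb T)$ for all sufficiently large $s$; (b) $u$ is a weak paraproduct solution of the stationary KdV equation. -/

import Mathlib

open MeasureTheory Filter Topology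
open scoped ENNReal ContDiff

/-! ## Distributions on the torus `𝕋 = ℝ / ℤ` -/

/-- Distributions on `ℝ / ℤ`, given by their Fourier coefficients: a sequence `ξ ↦ f̂(ξ)` is the
sequence of Fourier coefficients of a (unique) periodic distribution if and only if it grows at most
polynomially. -/
def torusDistributions : Submodule ℂ (ℤ → ℂ) where
  carrier := {c | ∃ (C : ℝ) (N : ℕ), ∀ ξ : ℤ, ‖c ξ‖ ≤ C * (1 + |(ξ : ℝ)|) ^ N}
  zero_mem' := ⟨0, 0, fun ξ => by simp⟩
  add_mem' := by
    rintro a b ⟨C, N, ha⟩ ⟨D, M, hb⟩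
    refine ⟨|C| + |D|, N + M, fun ξ => ?_⟩
    have h1 : (1 : ℝ) ≤ 1 + |(ξ : ℝ)| := le_add_of_nonneg_right (abs_nonneg _)
    have hN := pow_le_pow_right₀ h1 (Nat.le_add_right N M)
    have hM := pow_le_pow_right₀ h1 (Nat.le_add_left M N)
    calc ‖(a + b) ξ‖ ≤ ‖a ξ‖ + ‖b ξ‖ := norm_add_le _ _
      _ ≤ C * (1 + |(ξ : ℝ)|) ^ N + D * (1 + |(ξ : ℝ)|) ^ M := add_le_add (ha ξ) (hb ξ)
      _ ≤ |C| * (1 + |(ξ : ℝ)|) ^ N + |D| * (1 + |(ξ : ℝ)|) ^ M := by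
          gcongr <;> exact le_abs_self _
      _ ≤ |C| * (1 + |(ξ : ℝ)|) ^ (N + M) + |D| * (1 + |(ξ : ℝ)|) ^ (N + M) := by gcongr
      _ = (|C| + |D|) * (1 + |(ξ : ℝ)|) ^ (N + M) := by ring
  smul_mem' := by
    rintro k a ⟨C, N, ha⟩
    refine ⟨‖k‖ * C, N, fun ξ => ?_⟩
    rw [Pi.smul_apply, norm_smul, mul_assoc]
    exact mul_le_mul_of_nonneg_left (ha ξ) (norm_nonneg k)

/-- The type of distributions on `ℝ / ℤ`. -/
abbrev TorusDistribution : Type := torusDistributions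

namespace TorusDistribution

/-- The Fourier coefficient `f̂(ξ)`. -/
def coeff (f : TorusDistribution) (ξ : ℤ) : ℂ := f.1 ξ

/-- The distribution given by a function that is integrable on the torus, through its Fourier
coefficients `f̂(ξ) = ∫ f(x) e^{-2πiξx} dx`. -/
noncomputable def ofFun (f : UnitAddCircle → ℂ) : TorusDistribution :=
  ⟨fun ξ => fourierCoeff f ξ, ∫ x, ‖f x‖ ∂AddCircle.haarAddCircle, 0, fun ξ => by
    rw [pow_zero, mul_one]
    refine (norm_integral_le_integral_norm _).trans_eq ?_
    congr 1
    funext x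
    rw [norm_smul, fourier_apply, Circle.norm_coe, one_mul]⟩

/-- The projection off the mean, `P_{≠0}`: the Fourier coefficient at `0` is removed. -/
def meanFree (f : TorusDistribution) : TorusDistribution :=
  ⟨fun ξ => if ξ = 0 then 0 else f.1 ξ, by
    obtain ⟨C, N, h⟩ := f.2
    refine ⟨C, N, fun ξ => ?_⟩
    change ‖if ξ = 0 then 0 else f.1 ξ‖ ≤ _
    split_ifs with h0
    · rw [norm_zero]
      exact (norm_nonneg _).trans (h ξ)
    · exact h ξ⟩

/-- The pairing of a distribution with a smooth function, `⟨f, ψ⟩ = ∑_ξ f̂(ξ) ψ̂(-ξ)`. It is bilinear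
and extends `∫ f ψ`. The series converges absolutely for all distributions `f` and all smooth `ψ`;
for `f` in `Ḣ^s` and `ψ` smooth of mean zero it is the duality of `Ḣ^s` and `Ḣ^{-s}`. -/
noncomputable def pairing (f : TorusDistribution) (ψ : UnitAddCircle → ℂ) : ℂ :=
  ∑' ξ : ℤ, f.coeff ξ * fourierCoeff ψ (-ξ)

/-- The `Ḣ^s` norm `(∑_{ξ ≠ 0} |ξ|^{2s} |f̂(ξ)|²)^{1/2}`, with values in `[0, ∞]`. -/
noncomputable def hdotNorm (s : ℝ) (f : TorusDistribution) : ℝ≥0∞ :=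
  (∑' ξ : {ξ : ℤ // ξ ≠ 0},
    ENNReal.ofReal (|((ξ : ℤ) : ℝ)| ^ (2 * s) * ‖f.coeff (ξ : ℤ)‖ ^ 2)) ^ (1 / 2 : ℝ)

/-- `f ∈ Ḣ^s(𝕋)`. -/
def MemHdot (s : ℝ) (f : TorusDistribution) : Prop := hdotNorm s f < ⊤

end TorusDistribution

/-! ## Littlewood-Paley projectors -/

/-- The requirements on the function `φ` that generates the Littlewood-Paley projectors. -/
structure IsLPProfile (φ : ℝ → ℝ) : Prop where
  smooth : ContDiff ℝ ∞ φ
  mem_Icc : ∀ ξ, φ ξ ∈ Set.Icc (0 : ℝ) 1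
  even : ∀ ξ, φ (-ξ) = φ ξ
  tsupport_subset : tsupport φ ⊆ {ξ | 6 / 7 ≤ |ξ| ∧ |ξ| ≤ 2}
  eq_one : ∀ ξ, 1 ≤ |ξ| → |ξ| ≤ 12 / 7 → φ ξ = 1
  hasSum_one : ∀ ξ, 1 ≤ |ξ| → HasSum (fun j : ℕ => φ (ξ / 2 ^ j)) 1
  disjoint : ∀ j k : ℕ, j + 2 ≤ k →
    Disjoint (tsupport fun ξ => φ (ξ / 2 ^ j)) (tsupport fun ξ => φ (ξ / 2 ^ k))

/-- A function with these properties exists. -/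
theorem exists_isLPProfile : ∃ φ : ℝ → ℝ, IsLPProfile φ := by
  let S : ℝ → ℝ := fun ξ => Real.smoothTransition ((ξ ^ 2 - 36 / 49) * (49 / 13))
  have hS0 : ∀ ξ, |ξ| ≤ 6 / 7 → S ξ = 0 := fun ξ h => by
    refine Real.smoothTransition.zero_of_nonpos ?_
    have h2 : ξ ^ 2 ≤ (6 / 7) ^ 2 := by
      rw [← sq_abs]
      exact pow_le_pow_left₀ (abs_nonneg _) h 2
    nlinarith
  have hS1 : ∀ ξ, 1 ≤ |ξ| → S ξ = 1 := fun ξ h => by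
    refine Real.smoothTransition.one_of_one_le ?_
    have h2 : 1 ^ 2 ≤ ξ ^ 2 := by
      rw [← sq_abs ξ]
      exact pow_le_pow_left₀ zero_le_one h 2
    nlinarith
  have hSI : ∀ ξ, 0 ≤ S ξ ∧ S ξ ≤ 1 := fun ξ =>
    ⟨Real.smoothTransition.nonneg _, Real.smoothTransition.le_one _⟩
  have habs : ∀ (ξ : ℝ) (j : ℕ), |ξ / 2 ^ j| = |ξ| / 2 ^ j := fun ξ j => by
    rw [abs_div, abs_of_pos (by positivity : (0 : ℝ) < 2 ^ j)]
  have habs2 : ∀ ξ : ℝ, |ξ / 2| = |ξ| / 2 := fun ξ => by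
    rw [abs_div, abs_of_pos (by norm_num : (0 : ℝ) < 2)]
  have hSs : ContDiff ℝ ∞ S := by
    refine Real.smoothTransition.contDiff.comp ?_
    fun_prop
  let φ : ℝ → ℝ := fun ξ => S ξ - S (ξ / 2)
  have hI : ∀ ξ, φ ξ ∈ Set.Icc (0 : ℝ) 1 := fun ξ => by
    have h1 := hSI ξ
    have h2 := hSI (ξ / 2)
    rcases le_total |ξ| 1 with h | h
    · have h3 : S (ξ / 2) = 0 := hS0 _ (by rw [habs2]; linarith)
      simp only [φ, h3, Set.mem_Icc]
      constructor <;> linarith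
    · have h3 : S ξ = 1 := hS1 _ h
      simp only [φ, h3, Set.mem_Icc]
      constructor <;> linarith
  have hts : ∀ j : ℕ, tsupport (fun ξ => φ (ξ / 2 ^ j)) ⊆
      {ξ | 6 / 7 * 2 ^ j ≤ |ξ| ∧ |ξ| ≤ 2 * 2 ^ j} := fun j => by
    refine closure_minimal ?_ ((isClosed_le continuous_const continuous_abs).inter
      (isClosed_le continuous_abs continuous_const))
    intro ξ hξ
    have hp : (0 : ℝ) < 2 ^ j := by positivity
    rw [Function.mem_support] at hξ
    by_contra hc
    apply hξ
    rw [Set.mem_ofPred_eq, not_and_or, not_le, not_le] at hc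
    rcases hc with h | h
    · have h1 : |ξ / 2 ^ j| ≤ 6 / 7 := by
        rw [habs, div_le_iff₀ hp]
        exact h.le
      have h2 : |ξ / 2 ^ j / 2| ≤ 6 / 7 := by
        rw [habs2]
        linarith [abs_nonneg (ξ / 2 ^ j)]
      simp only [φ, hS0 _ h1, hS0 _ h2, sub_self]
    · have h1 : 2 ≤ |ξ / 2 ^ j| := by
        rw [habs, le_div_iff₀ hp]
        exact h.le
      have h2 : 1 ≤ |ξ / 2 ^ j / 2| := by
        rw [habs2]
        linarith
      simp only [φ, hS1 _ (by linarith : 1 ≤ |ξ / 2 ^ j|), hS1 _ h2, sub_self]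
  refine ⟨φ, ?_, hI, ?_, ?_, ?_, ?_, ?_⟩
  · exact hSs.sub (hSs.comp (by fun_prop))
  · intro ξ
    simp only [φ, S, neg_div, neg_sq]
  · simpa using hts 0
  · intro ξ h1 h2
    have h3 : S (ξ / 2) = 0 := hS0 _ (by rw [habs2]; linarith)
    simp only [φ, h3, hS1 _ h1, sub_zero]
  · intro ξ h1
    rw [hasSum_iff_tendsto_nat_of_nonneg (fun j => (hI _).1)]
    have hsum : ∀ n : ℕ, ∑ j ∈ Finset.range n, φ (ξ / 2 ^ j) = S ξ - S (ξ / 2 ^ n) := fun n => by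
      induction n with
      | zero => simp
      | succ n ih =>
        rw [Finset.sum_range_succ, ih]
        simp only [φ, div_div, pow_succ]
        ring
    simp only [hsum, hS1 _ h1]
    obtain ⟨N, hN⟩ := pow_unbounded_of_one_lt (2 * |ξ|) (one_lt_two : (1 : ℝ) < 2)
    refine tendsto_const_nhds.congr' ?_
    filter_upwards [eventually_ge_atTop N] with n hn
    have h2 : S (ξ / 2 ^ n) = 0 := hS0 _ (by
      rw [habs, div_le_iff₀ (by positivity)]
      have := pow_le_pow_right₀ (one_le_two : (1 : ℝ) ≤ 2) hn
      linarith [abs_nonneg ξ])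
    rw [h2, sub_zero]
  · intro j k hjk
    rw [Set.disjoint_left]
    intro ξ hj hk
    have h1 := (hts j hj).2
    have h2 := (hts k hk).1
    have h3 := pow_le_pow_right₀ (one_le_two : (1 : ℝ) ≤ 2) hjk
    have h4 : (0 : ℝ) < 2 ^ j := by positivity
    rw [pow_add] at h3
    linarith

/-- The projection on the `j`-th shell, `P_{2^j} f (x) = ∑_ξ f̂(ξ) φ(2^{-j} ξ) e^{2πiξx}`, a smooth
function (the sum has only finitely many nonzero terms). -/
noncomputable def lpBlock (φ : ℝ → ℝ) (j : ℕ) (f : TorusDistribution) : UnitAddCircle → ℂ :=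
  fun x => ∑' ξ : ℤ, f.coeff ξ * (φ ((ξ : ℝ) / 2 ^ j) : ℂ) * fourier ξ x

/-- `f` lies in the homogeneous Besov space `Ḃ^α_{∞,∞}(𝕋)`:
`sup_{j ≥ 0} 2^{jα} ‖P_{2^j} f‖_{L^∞} < ∞`. -/
def MemBesovInfty (φ : ℝ → ℝ) (α : ℝ) (f : TorusDistribution) : Prop :=
  (⨆ j : ℕ, ENNReal.ofReal ((2 : ℝ) ^ ((j : ℝ) * α)) * eLpNorm (lpBlock φ j f) ⊤ volume) < ⊤

/-! ## Paraproducts and weak paraproduct solutions -/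

/-- The term `P_{≠0}(P_{2^j}(f) P_{2^{j'}}(g))` for the pair `p = (j, j')`. -/
noncomputable def paraTerm (φ : ℝ → ℝ) (f g : TorusDistribution) (p : ℕ × ℕ) : TorusDistribution :=
  (TorusDistribution.ofFun fun x => lpBlock φ p.1 f x * lpBlock φ p.2 g x).meanFree

/-- `P_{≠0}(fg)` is well-defined as a paraproduct in `Ḣ^s(𝕋)`. -/
def ParaproductWellDefined (φ : ℝ → ℝ) (s : ℝ) (f g : TorusDistribution) : Prop :=
  (∑' p : ℕ × ℕ, (paraTerm φ f g p).hdotNorm s) < ⊤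

/-- `P_{≠0}(fg)` is well-defined as a paraproduct in `Ḣ^s(𝕋)`, and `Q` is its value: `Q` is the
mean-free element of `Ḣ^s` to which the series of the `P_{≠0}(P_{2^j}(f) P_{2^{j'}}(g))` converges
in `Ḣ^s`. -/
def IsParaproduct (φ : ℝ → ℝ) (s : ℝ) (f g Q : TorusDistribution) : Prop :=
  ParaproductWellDefined φ s f g ∧ Q.MemHdot s ∧ Q.coeff 0 = 0 ∧
    Tendsto (fun F : Finset (ℕ × ℕ) => (Q - ∑ p ∈ F, paraTerm φ f g p).hdotNorm s) atTop (𝓝 0)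

/-- Smooth functions on the torus. -/
def TorusSmooth (ψ : UnitAddCircle → ℂ) : Prop :=
  ContDiff ℝ ∞ fun t : ℝ => ψ (t : UnitAddCircle)

/-- The derivative of a function on the torus. -/
noncomputable def torusDeriv (ψ : UnitAddCircle → ℂ) : UnitAddCircle → ℂ :=
  fun x => deriv (fun t : ℝ => ψ (x + (t : UnitAddCircle))) 0

/-- `u` is a weak paraproduct solution of the stationary KdV equation `6 u u' - u''' = 0`. -/
def IsWeakParaproductSolution (φ : ℝ → ℝ) (u : TorusDistribution) : Prop :=
  (∃ s : ℝ, s < 0 ∧ u.MemHdot s) ∧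
  ∃ (s' : ℝ) (Q : TorusDistribution), IsParaproduct φ s' u u Q ∧
    ∀ ψ : UnitAddCircle → ℂ, TorusSmooth ψ →
      -u.pairing (torusDeriv (torusDeriv (torusDeriv ψ))) + 3 * Q.pairing (torusDeriv ψ) = 0

/-!
The solution is built by correcting one frequency of the equation `u'' = 3 P_{≠0}(u²)` at a time.
Let `u` be a real even trigonometric polynomial that satisfies the equation at the frequencies `±1,
…, ±(N - 1)`. Add the block

`w = M^{-1/2} ∑_{M ≤ m < 2M} (2 cos(2πλmx) + 2b cos(2π(λm + N)x))`

with a huge `λ`. The only frequencies of `2uw + w²` below `λ / 2` are `0` and `±N`, and the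
coefficient at `±N` is exactly `2b` (`sumForm_block_self`). Hence a suitable `b` makes the equation
hold at `±N` without disturbing the frequencies already treated (`Stage.exists_frequency`).
Although `w''` is huge, it lives at frequencies that are treated later.

The block is `2 Re((1 + b e^{2πiNx}) D_M(λx))` for a Dirichlet sum `D_M` which is normalized in
`L²` and concentrates at `0` as `M → ∞`. It therefore tends to `0` in `L^q` for `q < 2`, uniformly
in `λ` (`tendsto_eLpNorm_dirichletBlock`), so the blocks can be summed in all these spaces
(`IsStageSequence.exists_limit`). But each block adds at least `2` to the mean of `u²`, which
`P_{≠0}` ignores, so the limit is not in `L²` by Parseval's identity.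

Since `λ` is chosen after `M` and `b`, the sum of `|û(ξ)|` over `|ξ| ≤ N` is at most `log N`, which
gives the Besov bounds. For the paraproduct everything follows from the single estimate

`∑_{ξ + ζ ≠ 0} |û(ξ)| |û(ζ)| |ξ + ζ|^{-5} < ∞` (`IsStageSequence.summable_weight`).

The pairs with `|ξ + ζ| ≥ λ / 2` are harmless, and those with `ξ + ζ = ±N` inside the block that
treats `N` contribute a multiple of `|b| N^{-5}`, where `|b| ≤ 14 N³` because all coefficients of
`u²` at nonzero frequencies grow at most cubically throughout the construction
(`Stage.abs_correction_le`). As the Littlewood-Paley multipliers form a partition of unity and the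
`ℓ²` norm is at most the `ℓ¹` norm, the estimate bounds the sum of the norms of all paraproduct
terms. By Fubini the terms sum at each nonzero frequency to the convolution of `û` with itself,
which is `(u'')^ / 3` by construction (`IsConvolutionSolution.hasSum_tsum_paraCoeff`).
-/

/-! ### Sums over pairs of frequencies, and the perturbation blocks -/

/-- The bilinear form `∑_{x, y} f(x) g(y) κ(x + y)` on finitely supported sequences. For `κ = δ_η`
it is the convolution `(f * g)(η)`; for a weight `κ` it measures a product of trigonometric
polynomials in a weighted Wiener norm. -/
noncomputable def sumForm (κ : ℤ → ℝ) : (ℤ →₀ ℝ) →ₗ[ℝ] (ℤ →₀ ℝ) →ₗ[ℝ] ℝ :=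
  Finsupp.linearCombination ℝ fun x => Finsupp.linearCombination ℝ fun y => κ (x + y)

/-- The `ℓ¹` norm of a finitely supported sequence. -/
noncomputable def l1Norm (f : ℤ →₀ ℝ) : ℝ := f.sum fun _ a => |a|

theorem sumForm_single (κ : ℤ → ℝ) (x y : ℤ) (a b : ℝ) :
    sumForm κ (Finsupp.single x a) (Finsupp.single y b) = a * (b * κ (x + y)) := by
  simp [sumForm, Finsupp.linearCombination_single]

theorem sumForm_apply (κ : ℤ → ℝ) (f g : ℤ →₀ ℝ) :
    sumForm κ f g = ∑ x ∈ f.support, ∑ y ∈ g.support, f x * (g y * κ (x + y)) := by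
  simp [sumForm, Finsupp.linearCombination_apply, Finsupp.sum, LinearMap.sum_apply, Finset.mul_sum]

theorem sumForm_apply_of_subset (κ : ℤ → ℝ) (f g : ℤ →₀ ℝ) {s t : Finset ℤ} (hs : f.support ⊆ s)
    (ht : g.support ⊆ t) : sumForm κ f g = ∑ x ∈ s, ∑ y ∈ t, f x * (g y * κ (x + y)) := by
  rw [sumForm_apply]
  rw [Finset.sum_subset hs (fun x _ hx => by simp [Finsupp.notMem_support_iff.mp hx])]
  refine Finset.sum_congr rfl fun x _ => ?_
  exact Finset.sum_subset ht (fun y _ hy => by simp [Finsupp.notMem_support_iff.mp hy])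

theorem sumForm_comm (κ : ℤ → ℝ) (f g : ℤ →₀ ℝ) : sumForm κ f g = sumForm κ g f := by
  rw [sumForm_apply, sumForm_apply, Finset.sum_comm]
  refine Finset.sum_congr rfl fun x _ => Finset.sum_congr rfl fun y _ => ?_
  rw [add_comm x y]
  ring

theorem sumForm_add_add (κ : ℤ → ℝ) (f g : ℤ →₀ ℝ) :
    sumForm κ (f + g) (f + g) = sumForm κ f f + 2 * sumForm κ f g + sumForm κ g g := by
  simp only [map_add, LinearMap.add_apply]
  rw [sumForm_comm κ g f]
  ring

theorem abs_sumForm_le {κ : ℤ → ℝ} {f g : ℤ →₀ ℝ} {K : ℝ}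
    (h : ∀ x ∈ f.support, ∀ y ∈ g.support, |κ (x + y)| ≤ K) :
    |sumForm κ f g| ≤ l1Norm f * l1Norm g * K := by
  rw [sumForm_apply, l1Norm, l1Norm, Finsupp.sum, Finsupp.sum, Finset.sum_mul_sum, Finset.sum_mul]
  refine (Finset.abs_sum_le_sum_abs _ _).trans (Finset.sum_le_sum fun x hx => ?_)
  rw [Finset.sum_mul]
  refine (Finset.abs_sum_le_sum_abs _ _).trans (Finset.sum_le_sum fun y hy => ?_)
  rw [abs_mul, abs_mul, mul_assoc]
  gcongr
  exact h x hx y hy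

theorem l1Norm_eq_of_subset (f : ℤ →₀ ℝ) {s : Finset ℤ} (hs : f.support ⊆ s) :
    l1Norm f = ∑ x ∈ s, |f x| :=
  Finsupp.sum_of_support_subset f hs _ (by simp)

theorem l1Norm_nonneg (f : ℤ →₀ ℝ) : 0 ≤ l1Norm f := Finset.sum_nonneg fun _ _ => abs_nonneg _

theorem sum_abs_le_l1Norm (f : ℤ →₀ ℝ) (s : Finset ℤ) : ∑ x ∈ s, |f x| ≤ l1Norm f := by
  rw [l1Norm_eq_of_subset f (Finset.subset_union_left : f.support ⊆ f.support ∪ s)]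
  exact Finset.sum_le_sum_of_subset_of_nonneg Finset.subset_union_right fun _ _ _ => abs_nonneg _

theorem l1Norm_add_le (f g : ℤ →₀ ℝ) : l1Norm (f + g) ≤ l1Norm f + l1Norm g := by
  rw [l1Norm_eq_of_subset (f + g) Finsupp.support_add,
    l1Norm_eq_of_subset f (Finset.subset_union_left : f.support ⊆ f.support ∪ g.support),
    l1Norm_eq_of_subset g (Finset.subset_union_right : g.support ⊆ f.support ∪ g.support),
    ← Finset.sum_add_distrib]
  exact Finset.sum_le_sum fun x _ => abs_add_le _ _

theorem l1Norm_mono {f g : ℤ →₀ ℝ} (h : ∀ x, |f x| ≤ g x) : l1Norm f ≤ l1Norm g := by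
  rw [l1Norm_eq_of_subset f (Finset.subset_union_left : f.support ⊆ f.support ∪ g.support),
    l1Norm_eq_of_subset g (Finset.subset_union_right : g.support ⊆ f.support ∪ g.support)]
  exact Finset.sum_le_sum fun x _ => (h x).trans (le_abs_self _)

theorem l1Norm_smul (a : ℝ) (f : ℤ →₀ ℝ) : l1Norm (a • f) = |a| * l1Norm f := by
  rw [l1Norm_eq_of_subset (a • f) Finsupp.support_smul, l1Norm, Finsupp.sum, Finset.mul_sum]
  simp [abs_mul]

theorem l1Norm_single (x : ℤ) (a : ℝ) : l1Norm (Finsupp.single x a) = |a| := by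
  simp [l1Norm]

theorem l1Norm_sum_le {ι : Type*} (s : Finset ι) (f : ι → ℤ →₀ ℝ) :
    l1Norm (∑ i ∈ s, f i) ≤ ∑ i ∈ s, l1Norm (f i) :=
  Finset.le_sum_of_subadditive _ (by simp [l1Norm]) l1Norm_add_le s f

/-- The Fourier coefficients of `2 cos(2πkx) + 2b cos(2π(k + N)x)`. -/
noncomputable def cosPair (k N : ℤ) (b : ℝ) : ℤ →₀ ℝ :=
  Finsupp.single k 1 + Finsupp.single (-k) 1 + Finsupp.single (k + N) b +
    Finsupp.single (-(k + N)) b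

theorem l1Norm_cosPair_le (j N : ℤ) (b : ℝ) : l1Norm (cosPair j N b) ≤ 2 * (1 + |b|) := by
  unfold cosPair
  have h1 := l1Norm_add_le (Finsupp.single j 1 + Finsupp.single (-j) 1 + Finsupp.single (j + N) b)
    (Finsupp.single (-(j + N)) b)
  have h2 := l1Norm_add_le (Finsupp.single j 1 + Finsupp.single (-j) 1) (Finsupp.single (j + N) b)
  have h3 := l1Norm_add_le (Finsupp.single j (1 : ℝ)) (Finsupp.single (-j) 1)
  simp only [l1Norm_single, abs_one] at h1 h2 h3
  linarith

/-- The Fourier coefficients of the block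
`M^{-1/2} ∑_{M ≤ m < 2M} (2 cos(2πλmx) + 2b cos(2π(λm + N)x))`. Its square has the coefficient `2b`
at the frequencies `±N` and no other nonzero frequency below `λ / 2`. -/
noncomputable def block (M : ℕ) (lam N : ℤ) (b : ℝ) : ℤ →₀ ℝ :=
  ∑ m ∈ Finset.range M, (√M)⁻¹ • cosPair (lam * (M + m : ℕ)) N b

/-- Two cosine pairs at distant frequencies interact only at high frequencies. -/
theorem sumForm_cosPair_of_far {κ : ℤ → ℝ} {K : ℝ} {k l lam N : ℤ} {b : ℝ}
    (hK : ∀ η : ℤ, lam ≤ 2 * |η| → |κ η| ≤ K) (hN : 0 ≤ N) (hNl : 2 * N ≤ lam)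
    (hk : lam ≤ k) (hl : lam ≤ l) (hkl : lam ≤ |k - l|) :
    |sumForm κ (cosPair k N b) (cosPair l N b)| ≤ 4 * (1 + |b|) ^ 2 * K := by
  have hsupp : ∀ j : ℤ, ∀ x ∈ (cosPair j N b).support,
      x = j ∨ x = -j ∨ x = j + N ∨ x = -(j + N) := by
    intro j x hx
    by_contra hc
    apply Finsupp.mem_support_iff.mp hx
    simp only [cosPair, Finsupp.add_apply, Finsupp.single_apply]
    rw [if_neg, if_neg, if_neg, if_neg] <;> first | tauto | simp
  have hfar : ∀ x ∈ (cosPair k N b).support, ∀ y ∈ (cosPair l N b).support, |κ (x + y)| ≤ K := by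
    intro x hx y hy
    apply hK
    have := hsupp k x hx
    have := hsupp l y hy
    grind
  have hK0 : 0 ≤ K := (abs_nonneg _).trans (hK lam (by grind))
  refine (abs_sumForm_le hfar).trans ?_
  have h1 := mul_le_mul (l1Norm_cosPair_le k N b) (l1Norm_cosPair_le l N b)
    (l1Norm_nonneg _) (by positivity)
  calc _ ≤ (2 * (1 + |b|) * (2 * (1 + |b|))) * K := by gcongr
    _ = _ := by ring

theorem sumForm_cosPair_self {κ : ℤ → ℝ} {K : ℝ} {k lam N : ℤ} {b : ℝ}
    (hK : ∀ η : ℤ, lam ≤ 2 * |η| → |κ η| ≤ K) (hN : 0 ≤ N) (hl : 0 ≤ lam) (hk : lam ≤ k) :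
    |sumForm κ (cosPair k N b) (cosPair k N b) -
      ((2 + 2 * b ^ 2) * κ 0 + 2 * b * (κ N + κ (-N)))| ≤ 4 * (1 + |b|) ^ 2 * K := by
  have hK0 : 0 ≤ K := (abs_nonneg _).trans (hK lam (by grind))
  have e : sumForm κ (cosPair k N b) (cosPair k N b) -
      ((2 + 2 * b ^ 2) * κ 0 + 2 * b * (κ N + κ (-N))) =
      κ (2 * k) + κ (-(2 * k)) + 2 * (b * κ (2 * k + N)) + 2 * (b * κ (-(2 * k + N))) +
      b ^ 2 * κ (2 * k + 2 * N) + b ^ 2 * κ (-(2 * k + 2 * N)) := by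
    simp only [cosPair, map_add, LinearMap.add_apply, sumForm_single]
    rw [show k + k = 2 * k by ring, show -k + k = 0 by ring, show k + N + k = 2 * k + N by ring,
      show -(k + N) + k = -N by ring, show k + -k = 0 by ring, show -k + -k = -(2 * k) by ring,
      show k + N + -k = N by ring, show -(k + N) + -k = -(2 * k + N) by ring,
      show k + (k + N) = 2 * k + N by ring, show -k + (k + N) = N by ring,
      show k + N + (k + N) = 2 * k + 2 * N by ring, show -(k + N) + (k + N) = 0 by ring,
      show k + -(k + N) = -N by ring, show -k + -(k + N) = -(2 * k + N) by ring,
      show k + N + -(k + N) = 0 by ring, show -(k + N) + -(k + N) = -(2 * k + 2 * N) by ring]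
    ring
  have hb : ∀ η, lam ≤ 2 * |η| → |b * κ η| ≤ |b| * K := fun η h => by
    rw [abs_mul]
    exact mul_le_mul_of_nonneg_left (hK η h) (abs_nonneg b)
  have hb2 : ∀ η, lam ≤ 2 * |η| → |b ^ 2 * κ η| ≤ |b| ^ 2 * K := fun η h => by
    rw [abs_mul, abs_pow]
    exact mul_le_mul_of_nonneg_left (hK η h) (by positivity)
  have hp : ∀ t : ℤ, lam ≤ 2 * t → lam ≤ 2 * |t| := fun t h => by linarith [le_abs_self t]
  have hn : ∀ t : ℤ, lam ≤ 2 * t → lam ≤ 2 * |-t| := fun t h => by linarith [neg_le_abs (-t)]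
  have h1 := abs_le.mp (hK (2 * k) (hp _ (by linarith)))
  have h2 := abs_le.mp (hK (-(2 * k)) (hn _ (by linarith)))
  have h3 := abs_le.mp (hb (2 * k + N) (hp _ (by linarith)))
  have h4 := abs_le.mp (hb (-(2 * k + N)) (hn _ (by linarith)))
  have h5 := abs_le.mp (hb2 (2 * k + 2 * N) (hp _ (by linarith)))
  have h6 := abs_le.mp (hb2 (-(2 * k + 2 * N)) (hn _ (by linarith)))
  have h7 : 0 ≤ |b| * K := by positivity
  have h8 : 0 ≤ |b| ^ 2 * K := by positivity
  rw [e, abs_le]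
  constructor <;> nlinarith

theorem l1Norm_block_le (M : ℕ) (lam N : ℤ) (b : ℝ) :
    l1Norm (block M lam N b) ≤ 2 * (1 + |b|) * √M := by
  refine (l1Norm_sum_le _ _).trans ?_
  calc ∑ m ∈ Finset.range M, l1Norm ((√M)⁻¹ • cosPair (lam * (M + m : ℕ)) N b)
      ≤ ∑ m ∈ Finset.range M, (√M)⁻¹ * (2 * (1 + |b|)) := by
        refine Finset.sum_le_sum fun m _ => ?_
        rw [l1Norm_smul, abs_of_nonneg (by positivity)]
        gcongr
        exact l1Norm_cosPair_le _ _ _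
    _ = 2 * (1 + |b|) * √M := by
        rw [Finset.sum_const, Finset.card_range, nsmul_eq_mul, ← mul_assoc, ← div_eq_mul_inv,
          Real.div_sqrt]
        ring

/-- Up to frequencies of size at least `λ / 2`, only `0` and `±N` occur in the square of a block.
With `K = 0` this is an exact formula for the low coefficients of the square. -/
theorem sumForm_block_self {κ : ℤ → ℝ} {K : ℝ} {M : ℕ} {lam N : ℤ} {b : ℝ}
    (hK : ∀ η : ℤ, lam ≤ 2 * |η| → |κ η| ≤ K) (hM : 1 ≤ M) (hN : 0 ≤ N) (hl : 1 ≤ lam)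
    (hNl : 2 * N ≤ lam) :
    |sumForm κ (block M lam N b) (block M lam N b) -
      ((2 + 2 * b ^ 2) * κ 0 + 2 * b * (κ N + κ (-N)))| ≤ (2 * (1 + |b|) * √M) ^ 2 * K := by
  have hM0 : (0 : ℝ) < M := by exact_mod_cast hM
  have hinv : (√(M : ℝ))⁻¹ * (√(M : ℝ))⁻¹ = (M : ℝ)⁻¹ := by
    rw [← mul_inv, Real.mul_self_sqrt hM0.le]
  set P := (2 + 2 * b ^ 2) * κ 0 + 2 * b * (κ N + κ (-N))
  set v : ℕ → ℤ →₀ ℝ := fun m => cosPair (lam * (M + m : ℕ)) N b with hv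
  have hlow : ∀ m : ℕ, lam ≤ lam * (M + m : ℕ) := fun m => by
    have : (1 : ℤ) ≤ (M + m : ℕ) := by exact_mod_cast hM.trans (Nat.le_add_right _ _)
    nlinarith
  have e : sumForm κ (block M lam N b) (block M lam N b) - P =
      (M : ℝ)⁻¹ * ∑ m ∈ Finset.range M, ∑ l ∈ Finset.range M,
        (sumForm κ (v m) (v l) - if m = l then P else 0) := by
    have e1 : sumForm κ (block M lam N b) (block M lam N b) =
        (M : ℝ)⁻¹ * ∑ m ∈ Finset.range M, ∑ l ∈ Finset.range M, sumForm κ (v m) (v l) := by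
      simp only [block, map_sum, LinearMap.sum_apply, map_smul, LinearMap.smul_apply, smul_eq_mul,
        ← Finset.mul_sum, ← mul_assoc, hinv]
      rw [Finset.sum_comm]
    have e2 : ∑ m ∈ Finset.range M, ∑ l ∈ Finset.range M, (if m = l then P else 0) = M * P := by
      rw [Finset.sum_congr rfl fun m hm => (Finset.sum_ite_eq _ _ _).trans (if_pos hm)]
      simp
    simp only [Finset.sum_sub_distrib, e2, e1]
    field_simp
  rw [e, abs_mul, abs_of_pos (inv_pos.mpr hM0)]
  have hterm : ∀ m ∈ Finset.range M, ∀ l ∈ Finset.range M,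
      |sumForm κ (v m) (v l) - if m = l then P else 0| ≤ 4 * (1 + |b|) ^ 2 * K := by
    intro m _ l _
    split_ifs with h
    · subst h
      exact sumForm_cosPair_self hK hN (by lia) (hlow m)
    · rw [sub_zero]
      refine sumForm_cosPair_of_far hK hN hNl (hlow m) (hlow l) ?_
      rw [← mul_sub, abs_mul, abs_of_pos (by lia : 0 < lam)]
      have : 1 ≤ |((M + m : ℕ) : ℤ) - (M + l : ℕ)| := by
        refine Int.one_le_abs ?_
        push_cast
        lia
      nlinarith
  calc _ ≤ (M : ℝ)⁻¹ * ∑ m ∈ Finset.range M, ∑ l ∈ Finset.range M, 4 * (1 + |b|) ^ 2 * K := by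
        gcongr
        refine (Finset.abs_sum_le_sum_abs _ _).trans (Finset.sum_le_sum fun m hm => ?_)
        exact (Finset.abs_sum_le_sum_abs _ _).trans (Finset.sum_le_sum fun l hl => hterm m hm l hl)
    _ = (2 * (1 + |b|) * √M) ^ 2 * K := by
        simp only [Finset.sum_const, Finset.card_range, nsmul_eq_mul, mul_pow, Real.sq_sqrt hM0.le]
        field_simp
        ring

theorem abs_block_apply_le (M : ℕ) (lam N : ℤ) (b : ℝ) (x : ℤ) :
    |block M lam N b x| ≤ block M lam N |b| x := by
  simp only [block, Finsupp.finsetSum_apply, Finsupp.smul_apply, smul_eq_mul]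
  refine (Finset.abs_sum_le_sum_abs _ _).trans (Finset.sum_le_sum fun m _ => ?_)
  rw [abs_mul, abs_of_nonneg (by positivity : 0 ≤ (√(M : ℝ))⁻¹)]
  gcongr
  simp only [cosPair, Finsupp.add_apply, Finsupp.single_apply]
  refine (abs_add_le _ _).trans (add_le_add ((abs_add_le _ _).trans (add_le_add
    ((abs_add_le _ _).trans (add_le_add ?_ ?_)) ?_)) ?_) <;> split_ifs <;> simp

theorem block_apply_neg (M : ℕ) (lam N : ℤ) (b : ℝ) (x : ℤ) :
    block M lam N b (-x) = block M lam N b x := by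
  simp only [block, Finsupp.finsetSum_apply, Finsupp.smul_apply, smul_eq_mul]
  refine Finset.sum_congr rfl fun m _ => ?_
  congr 1
  generalize lam * ((M + m : ℕ) : ℤ) = k
  have h : ∀ (y : ℤ) (a : ℝ), Finsupp.single y a (-x) = Finsupp.single (-y) a x := fun y a => by
    simp only [Finsupp.single_apply, neg_eq_iff_eq_neg]
  simp only [cosPair, Finsupp.add_apply, h, neg_neg]
  ring

theorem block_apply_eq_zero {M : ℕ} {lam N : ℤ} {b : ℝ} (hM : 1 ≤ M) (hN : 0 ≤ N) (hl : 1 ≤ lam)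
    {x : ℤ} (hx : |x| < lam) : block M lam N b x = 0 := by
  simp only [block, Finsupp.finsetSum_apply, Finsupp.smul_apply, smul_eq_mul]
  refine Finset.sum_eq_zero fun m _ => ?_
  have h1 : lam ≤ lam * (M + m : ℕ) := by
    have : (1 : ℤ) ≤ (M + m : ℕ) := by exact_mod_cast hM.trans (Nat.le_add_right _ _)
    nlinarith
  generalize lam * ((M + m : ℕ) : ℤ) = k at h1
  rw [mul_eq_zero]
  right
  simp only [cosPair, Finsupp.add_apply, Finsupp.single_apply]
  rw [if_neg, if_neg, if_neg, if_neg] <;> grind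

/-! ### Frequency-by-frequency correction -/

/-- The indicator sequence of the frequency `η`. -/
def freqIndicator (η : ℤ) : ℤ → ℝ := fun ζ => if ζ = η then 1 else 0

/-- The weight `|η|^{-5}`, with value `0` at `η = 0`. -/
noncomputable def freqWeight (η : ℤ) : ℝ := (|(η : ℝ)| ^ 5)⁻¹

/-- The invariants of the construction after the frequencies `±1, …, ±n` have been treated: `f`
holds the Fourier coefficients of the approximate solution, and `g` majorizes their absolute
values. -/
structure Stage (n : ℕ) (f g : ℤ →₀ ℝ) : Prop where
  even : ∀ x, f (-x) = f x
  le_majorant : ∀ x, |f x| ≤ g x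
  sum_le_log : ∀ N : ℕ, 1 ≤ N → ∑ x ∈ Finset.Icc (-N : ℤ) N, g x ≤ Real.log N
  equation : ∀ k : ℕ, 1 ≤ k → k ≤ n →
    sumForm (freqIndicator k) f f = -(4 * Real.pi ^ 2 / 3) * k ^ 2 * f k
  growth : ∀ k : ℕ, 1 ≤ k → |sumForm (freqIndicator k) f f| ≤ 14 * (k : ℝ) ^ 3
  mass : n ≤ sumForm (freqIndicator 0) f f
  weight : sumForm freqWeight g g ≤ ∑ k ∈ Finset.range n, 60 / ((k : ℝ) + 1) ^ 2

theorem stage_zero : Stage 0 0 0 where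
  even := by simp
  le_majorant := by simp
  sum_le_log N hN := by simpa using Real.log_natCast_nonneg N
  equation := by simp
  growth k _ := by simp
  mass := by simp
  weight := by simp

theorem Stage.abs_apply_le {n : ℕ} {f g : ℤ →₀ ℝ} (h : Stage n f g) {N : ℕ} (hN : 1 ≤ N) :
    |f N| ≤ N := by
  have hN0 : (0 : ℝ) < N := by exact_mod_cast hN
  refine (h.le_majorant N).trans (((Finset.single_le_sum (f := fun x => g x) (fun x _ =>
    (abs_nonneg _).trans (h.le_majorant x)) (by simp)).trans (h.sum_le_log N hN)).trans ?_)
  linarith [Real.log_le_sub_one_of_pos hN0]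

/-- The parameter `b` of the block that corrects the frequency `n + 1`. -/
noncomputable def correction (n : ℕ) (f : ℤ →₀ ℝ) : ℝ :=
  -(sumForm (freqIndicator (n + 1 : ℕ)) f f +
    4 * Real.pi ^ 2 / 3 * ((n + 1 : ℕ) : ℝ) ^ 2 * f (n + 1 : ℕ)) / 2

theorem four_pi_sq_div_three_le : 4 * Real.pi ^ 2 / 3 ≤ 14 := by
  have h1 := Real.pi_lt_d2
  have h2 := Real.pi_pos
  nlinarith

/-- The cubic growth of the coefficients of `u²` bounds the parameter `b`, and thereby the low
frequency part of the square of the next block. -/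
theorem Stage.abs_correction_le {n : ℕ} {f g : ℤ →₀ ℝ} (h : Stage n f g) :
    |correction n f| ≤ 14 * ((n + 1 : ℕ) : ℝ) ^ 3 := by
  have h1 := h.growth (n + 1) (by lia)
  have h2 := h.abs_apply_le (N := n + 1) (by lia)
  have h3 : |4 * Real.pi ^ 2 / 3 * ((n + 1 : ℕ) : ℝ) ^ 2 * f (n + 1 : ℕ)| ≤
      14 * ((n + 1 : ℕ) : ℝ) ^ 2 * (n + 1 : ℕ) := by
    rw [abs_mul, abs_of_nonneg (by positivity : 0 ≤ 4 * Real.pi ^ 2 / 3 * ((n + 1 : ℕ) : ℝ) ^ 2)]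
    have := four_pi_sq_div_three_le
    gcongr
  have h4 := (abs_add_le _ _).trans (add_le_add h1 h3)
  rw [correction, neg_div, abs_neg, abs_div, abs_two, div_le_iff₀ two_pos]
  exact h4.trans_eq (by ring)

theorem abs_freqIndicator_le_one (η ζ : ℤ) : |freqIndicator η ζ| ≤ 1 := by
  unfold freqIndicator
  split_ifs <;> simp

theorem two_mul_mul_inv_pow_five_le {N b : ℝ} (hN : 0 < N) (hb : |b| ≤ 14 * N ^ 3) :
    2 * |b| * ((N ^ 5)⁻¹ + (N ^ 5)⁻¹) ≤ 56 / N ^ 2 := by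
  calc _ ≤ 2 * (14 * N ^ 3) * ((N ^ 5)⁻¹ + (N ^ 5)⁻¹) := by gcongr
    _ = _ := by
      field_simp
      ring

set_option maxHeartbeats 800000 in
/-- Adding a block of sufficiently high frequency leads to the next stage and leaves all treated
frequencies unchanged. -/
theorem Stage.exists_frequency {n : ℕ} {f g : ℤ →₀ ℝ} (h : Stage n f g) {M : ℕ} (hM : 1 ≤ M) :
    ∃ lam : ℕ, 2 ≤ lam ∧ (∀ x : ℤ, (f x ≠ 0 ∨ |x| ≤ n) →
      block M lam (n + 1 : ℕ) (correction n f) x = 0) ∧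
      Stage (n + 1) (f + block M lam (n + 1 : ℕ) (correction n f))
        (g + block M lam (n + 1 : ℕ) |correction n f|) := by
  set N := n + 1 with hN
  set b := correction n f with hb
  set A := 2 * (1 + |b|) * √M with hA
  set S := l1Norm g + A with hS
  have hA0 : 0 ≤ A := by positivity
  have hg0 := l1Norm_nonneg g
  have hfg : l1Norm f ≤ l1Norm g := l1Norm_mono h.le_majorant
  -- all frequencies of `f` and `g` lie in `[-D, D]`
  obtain ⟨D, hD⟩ : ∃ D : ℕ, ∀ x ∈ f.support ∪ g.support, |x| ≤ D := by
    refine ⟨(f.support ∪ g.support).sup Int.natAbs, fun x hx => ?_⟩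
    rw [Int.abs_eq_natAbs]
    exact_mod_cast Finset.le_sup (f := Int.natAbs) hx
  -- `exp S` gives the logarithmic bound on partial sums, `2 S` the growth bound at frequencies
  -- above `lam / 2`, and the last term the bound on the weighted interactions there
  obtain ⟨E, hE⟩ := exists_nat_ge (Real.exp S + 2 * S + 2 * S ^ 2 * (N : ℝ) ^ 2)
  set lam : ℕ := 4 * N + 2 * D + E with hlam
  have hlE : Real.exp S + 2 * S + 2 * S ^ 2 * (N : ℝ) ^ 2 ≤ lam :=
    hE.trans (by rw [hlam]; push_cast; linarith [(by positivity : 0 ≤ 4 * (N : ℝ) + 2 * D)])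
  have hexp : Real.exp S ≤ lam := by
    have : 0 ≤ 2 * S + 2 * S ^ 2 * (N : ℝ) ^ 2 := by positivity
    linarith
  have hlog : S ≤ Real.log lam := by
    rw [Real.le_log_iff_exp_le ((Real.exp_pos _).trans_le hexp)]
    exact hexp
  have h2S : 2 * S ≤ lam := by
    have : 0 ≤ Real.exp S + 2 * S ^ 2 * (N : ℝ) ^ 2 := by positivity
    linarith
  have h2SN : 2 * S ^ 2 * (N : ℝ) ^ 2 ≤ lam := by
    have : 0 ≤ Real.exp S + 2 * S := by positivity
    linarith
  set w := block M lam N b with hw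
  set W := block M lam N |b| with hW
  have hwA : l1Norm w ≤ A := l1Norm_block_le M lam N b
  have hWA : l1Norm W ≤ A := (l1Norm_block_le M lam N |b|).trans_eq (by rw [hA, abs_abs])
  have hfwS : l1Norm (f + w) ≤ S := (l1Norm_add_le f w).trans (add_le_add hfg hwA)
  have hgWS : l1Norm (g + W) ≤ S := (l1Norm_add_le g W).trans (by linarith)
  have hS0 : 0 ≤ S := by positivity
  have hwlow : ∀ x : ℤ, |x| < lam → w x = 0 := fun x hx =>
    block_apply_eq_zero hM (by positivity) (by lia) hx
  have hWlow : ∀ x : ℤ, |x| < lam → W x = 0 := fun x hx =>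
    block_apply_eq_zero hM (by positivity) (by lia) hx
  have hcross : ∀ {κ : ℤ → ℝ} {K : ℝ} {p q : ℤ →₀ ℝ}, (∀ η : ℤ, lam ≤ 2 * |η| → |κ η| ≤ K) →
      (∀ x ∈ p.support, |x| ≤ D) → (∀ x : ℤ, |x| < lam → q x = 0) →
      |sumForm κ p q| ≤ l1Norm p * l1Norm q * K := by
    intro κ K p q hK hp hq
    refine abs_sumForm_le fun x hx y hy => hK _ ?_
    have h1 := hp x hx
    have h2 : (lam : ℤ) ≤ |y| := by
      by_contra hc
      exact Finsupp.mem_support_iff.mp hy (hq y (not_le.mp hc))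
    have h3 : |y| ≤ |x + y| + |x| := by
      simpa using abs_sub (x + y) x
    lia
  have hfD : ∀ x ∈ f.support, |x| ≤ (D : ℤ) := fun x hx => hD x (Finset.mem_union_left _ hx)
  have hgD : ∀ x ∈ g.support, |x| ≤ (D : ℤ) := fun x hx => hD x (Finset.mem_union_right _ hx)
  -- at low frequencies the cross terms vanish and the block contributes only at `0` and `±N`
  have hlowform : ∀ k : ℕ, 2 * k < lam → sumForm (freqIndicator k) (f + w) (f + w) =
      sumForm (freqIndicator k) f f +
        if k = 0 then 2 + 2 * b ^ 2 else if k = N then 2 * b else 0 := by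
    intro k hk
    have hK : ∀ η : ℤ, lam ≤ 2 * |η| → |freqIndicator k η| ≤ 0 := by
      intro η hη
      rw [freqIndicator, if_neg, abs_zero]
      rintro rfl
      rw [Nat.abs_cast] at hη
      lia
    have h1 := hcross hK hfD hwlow
    have h2 := sumForm_block_self (b := b) (N := N) (lam := lam) hK hM (by positivity) (by lia)
      (by lia)
    rw [mul_zero, abs_nonpos_iff] at h1 h2
    rw [sumForm_add_add, h1, sub_eq_zero.mp h2]
    simp only [freqIndicator]
    have e1 : ((0 : ℤ) = k) ↔ k = 0 := by lia
    have e2 : ((N : ℤ) = k) ↔ k = N := by lia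
    have e3 : ¬ (-(N : ℤ) = k) := by lia
    simp only [e1, e2, e3, if_false]
    split_ifs with h3 h4
    · lia
    · ring
    · ring
    · ring
  have hsol : sumForm (freqIndicator N) f f + 2 * b =
      -(4 * Real.pi ^ 2 / 3) * (N : ℝ) ^ 2 * f N := by
    rw [hb, correction]
    ring
  refine ⟨lam, by lia, ?_, ?_⟩
  · intro x hx
    refine hwlow x ?_
    rcases hx with hx | hx
    · have := hfD x (Finsupp.mem_support_iff.mpr hx)
      lia
    · lia
  refine ⟨?_, ?_, ?_, ?_, ?_, ?_, ?_⟩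
  · intro x
    rw [Finsupp.add_apply, Finsupp.add_apply, h.even, block_apply_neg]
  · intro x
    rw [Finsupp.add_apply, Finsupp.add_apply]
    exact (abs_add_le _ _).trans (add_le_add (h.le_majorant x) (abs_block_apply_le M lam N b x))
  · intro K hK
    rcases lt_or_ge K lam with hKl | hKl
    · rw [Finset.sum_congr rfl fun x hx => ?_]
      · exact h.sum_le_log K hK
      · rw [Finset.mem_Icc] at hx
        rw [Finsupp.add_apply, hWlow x (by rw [abs_lt]; lia), add_zero]
    · calc ∑ x ∈ Finset.Icc (-K : ℤ) K, (g + W) x ≤ ∑ x ∈ Finset.Icc (-K : ℤ) K, |(g + W) x| :=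
            Finset.sum_le_sum fun x _ => le_abs_self _
        _ ≤ S := (sum_abs_le_l1Norm _ _).trans hgWS
        _ ≤ Real.log lam := hlog
        _ ≤ Real.log K := Real.log_le_log (by exact_mod_cast (by lia : 0 < lam))
            (by exact_mod_cast hKl)
  · intro k hk1 hkN
    rw [hlowform k (by lia), if_neg (by lia), Finsupp.add_apply, hwlow k (by
      rw [Nat.abs_cast]; lia), add_zero]
    split_ifs with hk
    · rw [hk, hsol]
    · rw [add_zero, h.equation k hk1 (by lia)]
  · intro k hk1
    have hk1' : (1 : ℝ) ≤ k := by exact_mod_cast hk1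
    rcases lt_or_ge (2 * k) lam with hk | hk
    · rw [hlowform k hk, if_neg (by lia)]
      split_ifs with hkN
      · subst hkN
        have h1 := h.abs_apply_le hk1
        have h2 := four_pi_sq_div_three_le
        rw [hsol, abs_mul, abs_mul, abs_neg,
          abs_of_nonneg (by positivity : 0 ≤ 4 * Real.pi ^ 2 / 3),
          abs_of_nonneg (by positivity : 0 ≤ (N : ℝ) ^ 2)]
        calc _ ≤ 14 * (N : ℝ) ^ 2 * N := by gcongr
          _ = _ := by ring
      · rw [add_zero]
        exact h.growth k hk1
    · have h1 := abs_sumForm_le (κ := freqIndicator k) (f := f + w) (g := f + w) (K := 1)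
        fun x _ y _ => abs_freqIndicator_le_one _ _
      have hk' : (lam : ℝ) ≤ 2 * k := by exact_mod_cast hk
      have hSk : S ≤ k := by linarith
      have h2 : l1Norm (f + w) ≤ k := hfwS.trans hSk
      have h3 := l1Norm_nonneg (f + w)
      calc _ ≤ _ := h1
        _ ≤ (k : ℝ) * k * 1 := by gcongr
        _ ≤ 14 * (k : ℝ) ^ 3 := by nlinarith [mul_nonneg (sub_nonneg.mpr hk1') (sq_nonneg (k : ℝ))]
  · have h1 := hlowform 0 (by lia)
    rw [if_pos rfl, Nat.cast_zero] at h1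
    rw [h1, hN]
    push_cast
    nlinarith [h.mass, sq_nonneg b]
  · have hN1 : (1 : ℝ) ≤ N := by exact_mod_cast (by lia : 1 ≤ N)
    have hl0 : (0 : ℝ) < lam := by exact_mod_cast (by lia : 0 < lam)
    have hK : ∀ η : ℤ, lam ≤ 2 * |η| → |freqWeight η| ≤ 2 / lam := by
      intro η hη
      have h1 : (1 : ℝ) ≤ |(η : ℝ)| := by
        exact_mod_cast (by lia : 1 ≤ |η|)
      have h2 : (lam : ℝ) ≤ 2 * |(η : ℝ)| := by exact_mod_cast hη
      rw [freqWeight, abs_of_nonneg (by positivity), inv_le_comm₀ (by positivity) (by positivity),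
        inv_div]
      calc (lam : ℝ) / 2 ≤ |(η : ℝ)| := by linarith
        _ ≤ |(η : ℝ)| ^ 5 := le_self_pow₀ h1 (by norm_num)
    have hb3 := h.abs_correction_le
    rw [← hb, ← hN] at hb3
    have h1 := (abs_le.mp (hcross hK hgD hWlow)).2
    have h2 := (abs_le.mp (sumForm_block_self (b := |b|) (N := N) (lam := lam) hK hM
      (by positivity) (by lia) (by lia))).2
    rw [abs_abs, ← hA, ← hW] at h2
    have h3 : freqWeight 0 = 0 := by simp [freqWeight]
    have h4 : freqWeight N = ((N : ℝ) ^ 5)⁻¹ := by simp [freqWeight]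
    have h5 : freqWeight (-N) = ((N : ℝ) ^ 5)⁻¹ := by simp [freqWeight]
    rw [h3, h4, h5] at h2
    have h6 : l1Norm g * l1Norm W * (2 / lam) ≤ l1Norm g * A * (2 / lam) := by gcongr
    have h7 : 2 * (l1Norm g * A * (2 / lam)) + A ^ 2 * (2 / lam) ≤ 1 / (N : ℝ) ^ 2 := by
      calc _ ≤ S ^ 2 * (2 / lam) := by
            rw [hS, ← sub_nonneg]
            have : 0 ≤ (l1Norm g) ^ 2 * (2 / lam) := by positivity
            linarith [this, (by ring : (l1Norm g + A) ^ 2 * (2 / lam : ℝ) - (2 * (l1Norm g * A *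
              (2 / lam)) + A ^ 2 * (2 / lam)) = (l1Norm g) ^ 2 * (2 / lam))]
        _ ≤ 1 / (N : ℝ) ^ 2 := by
            rw [mul_div_assoc', div_le_div_iff₀ hl0 (by positivity)]
            linarith
    have h8 := two_mul_mul_inv_pow_five_le (by linarith : (0 : ℝ) < N) hb3
    have h9 : (60 : ℝ) / (N : ℝ) ^ 2 = 56 / (N : ℝ) ^ 2 + 1 / (N : ℝ) ^ 2 + 3 / (N : ℝ) ^ 2 := by
      ring
    have h10 : 0 ≤ 3 / (N : ℝ) ^ 2 := by positivity
    have h11 := h.weight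
    have h12 : ((n : ℝ) + 1) = N := by rw [hN]; push_cast; rfl
    rw [Finset.sum_range_succ, sumForm_add_add, h12]
    linarith

/-! ### Smallness in `L^q` for `q < 2` -/

/-- On a probability space, a sequence that is bounded in `L²` and tends to `0` almost everywhere
tends to `0` in `L^q` for `q < 2`. -/
theorem tendsto_eLpNorm_zero_of_bounded_two {α : Type*} {m : MeasurableSpace α} {μ : Measure α}
    [IsFiniteMeasure μ] {f : ℕ → α → ℂ} (hf : ∀ n, AEStronglyMeasurable (f n) μ)
    (h2 : ∀ n, eLpNorm (f n) 2 μ ≤ 1) (h0 : ∀ᵐ x ∂μ, Tendsto (fun n => f n x) atTop (𝓝 0))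
    {q : ℝ≥0∞} (hq1 : 1 ≤ q) (hq2 : q < 2) : Tendsto (fun n => eLpNorm (f n) q μ) atTop (𝓝 0) := by
  have hqtop : q ≠ ⊤ := (hq2.trans (by simp)).ne
  set θ : ℝ := 1 / q.toReal - 1 / (2 : ℝ≥0∞).toReal with hθ
  have hθ0 : 0 < θ := by
    have h1 : q.toReal < 2 := by
      simpa using (ENNReal.toReal_lt_toReal hqtop (by simp)).mpr hq2
    have h3 : 0 < q.toReal := ENNReal.toReal_pos (zero_lt_one.trans_le hq1).ne' hqtop
    rw [hθ, ENNReal.toReal_ofNat, sub_pos]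
    exact one_div_lt_one_div_of_lt h3 h1
  have hui : UnifIntegrable f q μ := by
    intro ε hε
    refine ⟨ε ^ θ⁻¹, by positivity, fun n s hs hμ => ?_⟩
    rw [eLpNorm_indicator_eq_eLpNorm_restrict hs]
    refine (eLpNorm_le_eLpNorm_mul_rpow_measure_univ hq2.le (hf n).restrict).trans ?_
    rw [Measure.restrict_apply_univ]
    calc _ ≤ 1 * (ENNReal.ofReal (ε ^ θ⁻¹)) ^ θ := by
          gcongr
          exact (eLpNorm_restrict_le _ _ _ _).trans (h2 n)
      _ = ENNReal.ofReal ε := by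
          rw [one_mul, ENNReal.ofReal_rpow_of_nonneg (by positivity) hθ0.le,
            Real.rpow_inv_rpow hε.le hθ0.ne']
  have := tendsto_Lp_finite_of_tendsto_ae hq1 hqtop hf (MemLp.zero (ε := ℂ)) hui (g := 0) h0
  simpa using this

/-- The normalized Dirichlet sum `M^{-1/2} ∑_{M ≤ m < 2M} e^{2πimx}`. -/
noncomputable def dirichletBlock (M : ℕ) : C(UnitAddCircle, ℂ) :=
  ∑ m ∈ Finset.range M, (((√M)⁻¹ : ℝ) : ℂ) • fourier (M + m : ℕ)

theorem UnitAddCircle.volume_eq_haar :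
    (volume : Measure UnitAddCircle) = AddCircle.haarAddCircle := by
  rw [AddCircle.volume_eq_smul_haarAddCircle, ENNReal.ofReal_one, one_smul]

theorem eLpNorm_dirichletBlock_two_le (M : ℕ) : eLpNorm (dirichletBlock M) 2 volume ≤ 1 := by
  rw [UnitAddCircle.volume_eq_haar]
  set v : Lp ℂ 2 (AddCircle.haarAddCircle : Measure UnitAddCircle) :=
    ContinuousMap.toLp (E := ℂ) 2 AddCircle.haarAddCircle ℂ (dirichletBlock M) with hv
  have h1 : eLpNorm (dirichletBlock M) 2 (AddCircle.haarAddCircle : Measure UnitAddCircle) =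
      eLpNorm v 2 AddCircle.haarAddCircle :=
    eLpNorm_congr_ae (ContinuousMap.coeFn_toLp _ _).symm
  have h2 : v = ∑ m ∈ Finset.range M, (((√M)⁻¹ : ℝ) : ℂ) • fourierLp 2 ((M + m : ℕ) : ℤ) := by
    simp only [hv, dirichletBlock, map_sum, map_smul]
  have h3 : Orthonormal ℂ fun m : ℕ => (fourierLp 2 ((M + m : ℕ) : ℤ) :
      Lp ℂ 2 (AddCircle.haarAddCircle : Measure UnitAddCircle)) :=
    orthonormal_fourier.comp (fun m : ℕ => ((M + m : ℕ) : ℤ)) (fun a b h => by simpa using h)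
  have h4 : ‖v‖ ^ 2 ≤ 1 := by
    have h5 := h3.inner_sum (fun _ => (((√M)⁻¹ : ℝ) : ℂ)) (fun _ => (((√M)⁻¹ : ℝ) : ℂ))
      (Finset.range M)
    rw [← h2, inner_self_eq_norm_sq_to_K] at h5
    have h6 : ((‖v‖ ^ 2 : ℝ) : ℂ) = ((M * ((√M)⁻¹ * (√M)⁻¹) : ℝ) : ℂ) := by
      push_cast
      simpa using h5
    rw [Complex.ofReal_inj.mp h6, ← mul_inv, Real.mul_self_sqrt (Nat.cast_nonneg M)]
    exact mul_inv_le_one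
  rw [h1, ← ENNReal.ofReal_toReal (Lp.eLpNorm_ne_top v), ← Lp.norm_def]
  rw [ENNReal.ofReal_le_one]
  exact (sq_le_one_iff₀ (norm_nonneg v)).mp h4

theorem fourier_natCast_eq_pow (n : ℕ) (x : UnitAddCircle) :
    fourier (n : ℤ) x = (fourier 1 x : ℂ) ^ n := by
  induction n with
  | zero => simp
  | succ n ih => rw [Nat.cast_succ, fourier_add, ih, pow_succ]

theorem tendsto_dirichletBlock_ae :
    ∀ᵐ x : UnitAddCircle, Tendsto (fun M => dirichletBlock M x) atTop (𝓝 0) := by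
  have h0 : ∀ᵐ x : UnitAddCircle, x ≠ 0 := by
    rw [ae_iff]
    have h1 := AddCircle.volume_closedBall (T := 1) (x := 0) 0
    rw [Metric.closedBall_zero] at h1
    simpa [Set.ofPred_eq_eq_singleton] using h1
  filter_upwards [h0] with x hx
  set z : ℂ := fourier 1 x with hz
  have hz1 : z ≠ 1 := fun h => hx (by
    have h1 : (AddCircle.toCircle x : ℂ) = 1 := by rw [← fourier_one]; exact h
    have h2 : AddCircle.toCircle x = AddCircle.toCircle (0 : UnitAddCircle) := by
      apply Circle.ext
      rw [h1, fourier_zero']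
    exact AddCircle.injective_toCircle one_ne_zero h2)
  have hnz : ‖z‖ = 1 := by rw [hz, fourier_apply]; exact Circle.norm_coe _
  have hval : ∀ M, dirichletBlock M x = (((√M)⁻¹ : ℝ) : ℂ) * (z ^ M * ((z ^ M - 1) / (z - 1))) := by
    intro M
    rw [← geom_sum_eq hz1, dirichletBlock]
    simp only [ContinuousMap.sum_apply, ContinuousMap.smul_apply, fourier_natCast_eq_pow,
      smul_eq_mul, ← Finset.mul_sum, pow_add, hz]
  refine squeeze_zero_norm (a := fun M : ℕ => (√M)⁻¹ * (2 / ‖z - 1‖)) (fun M => ?_) ?_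
  · rw [hval, norm_mul, norm_mul, norm_pow, hnz, one_pow, one_mul, norm_div, Complex.norm_real,
      Real.norm_of_nonneg (by positivity)]
    gcongr
    refine (norm_sub_le _ _).trans ?_
    rw [norm_pow, hnz, one_pow, norm_one]
    norm_num
  · have h1 : Tendsto (fun M : ℕ => (√(M : ℝ))⁻¹) atTop (𝓝 0) :=
      tendsto_inv_atTop_zero.comp (Real.tendsto_sqrt_atTop.comp tendsto_natCast_atTop_atTop)
    simpa using h1.mul_const (2 / ‖z - 1‖)

/-- The Dirichlet sums, normalized in `L²`, are small in `L^q` for `q < 2`. -/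
theorem tendsto_eLpNorm_dirichletBlock {q : ℝ≥0∞} (hq1 : 1 ≤ q) (hq2 : q < 2) :
    Tendsto (fun M => eLpNorm (dirichletBlock M) q volume) atTop (𝓝 0) :=
  tendsto_eLpNorm_zero_of_bounded_two
    (fun M => (dirichletBlock M).continuous.aestronglyMeasurable) eLpNorm_dirichletBlock_two_le
    tendsto_dirichletBlock_ae hq1 hq2

/-- The trigonometric polynomial with Fourier coefficients `f`. -/
noncomputable def trigPoly : (ℤ →₀ ℝ) →ₗ[ℝ] C(UnitAddCircle, ℂ) :=
  Finsupp.linearCombination ℝ fun ξ => fourier ξ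

/-- The real part of `trigPoly f`, which is all of it if `f` is even. -/
noncomputable def trigFun (f : ℤ →₀ ℝ) (x : UnitAddCircle) : ℝ := (trigPoly f x).re

theorem trigPoly_apply (f : ℤ →₀ ℝ) (x : UnitAddCircle) :
    trigPoly f x = ∑ ξ ∈ f.support, f ξ * fourier ξ x := by
  simp [trigPoly, Finsupp.linearCombination_apply, Finsupp.sum]

theorem continuous_trigFun (f : ℤ →₀ ℝ) : Continuous (trigFun f) :=
  Complex.continuous_re.comp (trigPoly f).continuous

theorem trigFun_add (f g : ℤ →₀ ℝ) (x : UnitAddCircle) :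
    trigFun (f + g) x = trigFun f x + trigFun g x := by
  simp [trigFun]

theorem ofReal_trigFun {f : ℤ →₀ ℝ} (hf : ∀ x, f (-x) = f x) (x : UnitAddCircle) :
    (trigFun f x : ℂ) = trigPoly f x := by
  rw [trigFun, ← Complex.conj_eq_iff_re, trigPoly_apply, map_sum]
  refine Finset.sum_nbij' (fun ξ => -ξ) (fun ξ => -ξ) ?_ ?_ ?_ ?_ ?_
  · simp [hf]
  · simp [hf]
  · simp
  · simp
  · intro ξ _
    simp only [map_mul, Complex.conj_ofReal, hf, fourier_neg]

theorem fourierCoeff_trigPoly (f : ℤ →₀ ℝ) (ξ : ℤ) : fourierCoeff (trigPoly f) ξ = f ξ := by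
  have h : (trigPoly f : UnitAddCircle → ℂ) =
      ∑ η ∈ f.support, fun x => (f η : ℂ) * fourier η x := by
    funext x
    rw [trigPoly_apply, Finset.sum_apply]
  rw [h, fourierCoeff.sum]
  · simp only [Finset.sum_apply, fourierCoeff.const_mul, fourierCoeff_fourier, Pi.single_apply]
    simp +contextual
  · intro η _
    exact (((fourier η).continuous.const_smul (f η : ℂ)).integrable_of_hasCompactSupport
      (HasCompactSupport.of_compactSpace _))

theorem abs_trigFun_block_le (M lam N : ℕ) (b : ℝ) (x : UnitAddCircle) :
    ‖trigFun (block M lam N b) x‖ ≤ 2 * (1 + |b|) * ‖dirichletBlock M (lam • x)‖ := by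
  have hf : ∀ k : ℤ, ∀ y : UnitAddCircle, fourier (lam * k) y = (fourier k (lam • y) : ℂ) := by
    intro k y
    rw [fourier_apply, fourier_apply, mul_comm, mul_zsmul, natCast_zsmul]
  have hpair : ∀ k : ℤ, (trigPoly (cosPair k N b) x).re =
      2 * ((1 + b * fourier (N : ℤ) x) * fourier k x : ℂ).re := by
    intro k
    simp only [cosPair, map_add, trigPoly, Finsupp.linearCombination_single,
      ContinuousMap.add_apply, ContinuousMap.smul_apply, fourier_neg, fourier_add]
    simp
    ring
  have e : trigFun (block M lam N b) x =
      2 * ((1 + b * fourier (N : ℤ) x) * dirichletBlock M (lam • x) : ℂ).re := by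
    simp only [trigFun, block, dirichletBlock, map_sum, map_smul, ContinuousMap.sum_apply,
      ContinuousMap.smul_apply, Complex.re_sum, Complex.real_smul, Complex.re_ofReal_mul, hpair, hf,
      Finset.mul_sum, smul_eq_mul]
    refine Finset.sum_congr rfl fun m _ => ?_
    rw [mul_left_comm (1 + (b : ℂ) * fourier (N : ℤ) x), Complex.re_ofReal_mul]
    ring
  rw [e, norm_mul, Real.norm_two, mul_assoc]
  gcongr
  refine (Complex.abs_re_le_norm _).trans ?_
  rw [norm_mul]
  gcongr
  refine (norm_add_le _ _).trans ?_
  rw [norm_one, norm_mul, Complex.norm_real, fourier_apply, Circle.norm_coe, mul_one,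
    Real.norm_eq_abs]

theorem eLpNorm_trigFun_block_le {M lam N : ℕ} (hlam : 2 ≤ lam) (b : ℝ) (q : ℝ≥0∞) :
    eLpNorm (trigFun (block M lam N b)) q volume ≤
      ENNReal.ofReal (2 * (1 + |b|)) * eLpNorm (dirichletBlock M) q volume := by
  have hmp : MeasurePreserving (fun y : UnitAddCircle => lam • y) volume volume :=
    (AddCircle.ergodic_nsmul (by lia)).toMeasurePreserving
  rw [← eLpNorm_comp_measurePreserving (dirichletBlock M).continuous.aestronglyMeasurable hmp]
  exact eLpNorm_le_mul_eLpNorm_of_ae_le_mul (ae_of_all _ (abs_trigFun_block_le M lam N b)) q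

/-- One step of the construction: the frequency `n + 1` is corrected by a perturbation that is as
small in `L^q`, `q < 2`, as desired. -/
theorem Stage.exists_next {n : ℕ} {f g : ℤ →₀ ℝ} (h : Stage n f g) {q : ℝ≥0∞} (hq1 : 1 ≤ q)
    (hq2 : q < 2) {ε : ℝ≥0∞} (hε : ε ≠ 0) : ∃ w W : ℤ →₀ ℝ, Stage (n + 1) (f + w) (g + W) ∧
      (∀ x : ℤ, (f x ≠ 0 ∨ |x| ≤ n) → w x = 0) ∧ eLpNorm (trigFun w) q volume ≤ ε := by
  set C := ENNReal.ofReal (2 * (1 + |correction n f|)) with hC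
  have h1 : Tendsto (fun M => C * eLpNorm (dirichletBlock M) q volume) atTop (𝓝 0) := by
    rw [← mul_zero C]
    exact ENNReal.Tendsto.const_mul (tendsto_eLpNorm_dirichletBlock hq1 hq2)
      (Or.inr ENNReal.ofReal_ne_top)
  obtain ⟨M, hMε, hM⟩ := ((h1.eventually_le_const (pos_iff_ne_zero.mpr hε)).and
    (eventually_ge_atTop 1)).exists
  obtain ⟨lam, hlam, h2, h3⟩ := h.exists_frequency hM
  refine ⟨_, _, h3, h2, ?_⟩
  have h4 := eLpNorm_trigFun_block_le (M := M) (N := n + 1) hlam (correction n f) q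
  exact h4.trans hMε

/-! ### The limiting sequence of Fourier coefficients -/

/-- A sequence of approximate solutions, each obtained from the preceding one by a correction of the
next frequency. -/
structure IsStageSequence (f g : ℕ → ℤ →₀ ℝ) : Prop where
  stage : ∀ n, Stage n (f n) (g n)
  stable : ∀ n x, (f n x ≠ 0 ∨ |x| ≤ n) → f (n + 1) x = f n x
  small : ∀ n : ℕ, eLpNorm (trigFun (f (n + 1)) - trigFun (f n))
    (ENNReal.ofReal (2 - 1 / ((n : ℝ) + 1))) volume ≤ 2⁻¹ ^ n

theorem exists_isStageSequence : ∃ f g : ℕ → ℤ →₀ ℝ, IsStageSequence f g := by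
  have step : ∀ n : ℕ, ∀ p : {p : (ℤ →₀ ℝ) × (ℤ →₀ ℝ) // Stage n p.1 p.2},
      ∃ p' : {p : (ℤ →₀ ℝ) × (ℤ →₀ ℝ) // Stage (n + 1) p.1 p.2},
        (∀ x, (p.1.1 x ≠ 0 ∨ |x| ≤ n) → p'.1.1 x = p.1.1 x) ∧
        eLpNorm (trigFun p'.1.1 - trigFun p.1.1)
          (ENNReal.ofReal (2 - 1 / ((n : ℝ) + 1))) volume ≤ 2⁻¹ ^ n := by
    rintro n ⟨⟨f, g⟩, h⟩
    have h1 : (1 : ℝ) / (n + 1) ≤ 1 := by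
      rw [div_le_one (by positivity)]
      linarith [(Nat.cast_nonneg n : (0 : ℝ) ≤ n)]
    have h2 : (0 : ℝ) < 1 / (n + 1) := by positivity
    obtain ⟨w, W, h3, h4, h5⟩ := h.exists_next
      (q := ENNReal.ofReal (2 - 1 / ((n : ℝ) + 1))) (ε := 2⁻¹ ^ n)
      (by rw [ENNReal.one_le_ofReal]; linarith)
      (by rw [← ENNReal.ofReal_ofNat 2, ENNReal.ofReal_lt_ofReal_iff two_pos]; linarith)
      (by simp)
    refine ⟨⟨⟨f + w, g + W⟩, h3⟩, fun x hx => ?_, ?_⟩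
    · simp [h4 x hx]
    · have : trigFun (f + w) - trigFun f = trigFun w := by
        funext x
        simp [trigFun_add]
      simpa only [this] using h5
  choose next hnext using step
  let F : ∀ n : ℕ, {p : (ℤ →₀ ℝ) × (ℤ →₀ ℝ) // Stage n p.1 p.2} :=
    fun n => Nat.rec ⟨(0, 0), stage_zero⟩ next n
  exact ⟨fun n => (F n).1.1, fun n => (F n).1.2, fun n => (F n).2, fun n => (hnext n (F n)).1,
    fun n => (hnext n (F n)).2⟩

/-- A sequence of real Fourier coefficients that solves `u'' = 3 P_{≠0}(u²)` frequency by frequency,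
with absolutely convergent convolutions: even after division by `|η|^5`, summed over all `η ≠ 0`. -/
structure IsConvolutionSolution (c : ℤ → ℝ) : Prop where
  sum_le_log : ∀ N : ℕ, 1 ≤ N → ∑ x ∈ Finset.Icc (-N : ℤ) N, |c x| ≤ Real.log N
  summable_weight : Summable fun p : ℤ × ℤ => |c p.1| * |c p.2| * freqWeight (p.1 + p.2)
  hasSum_mul : ∀ η : ℤ, η ≠ 0 →
    HasSum (fun x => c x * c (η - x)) (-(4 * Real.pi ^ 2 / 3) * η ^ 2 * c η)

theorem freqWeight_nonneg (η : ℤ) : 0 ≤ freqWeight η := by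
  unfold freqWeight
  positivity

theorem summable_mul_of_summable_weight {c : ℤ → ℝ}
    (h : Summable fun p : ℤ × ℤ => |c p.1| * |c p.2| * freqWeight (p.1 + p.2)) {η : ℤ}
    (hη : η ≠ 0) : Summable fun x => |c x| * |c (η - x)| := by
  have h1 := h.comp_injective (i := fun x : ℤ => (x, η - x)) fun x y hxy => (Prod.ext_iff.mp hxy).1
  have h2 : freqWeight η ≠ 0 := by
    unfold freqWeight
    positivity
  refine (summable_mul_right_iff h2).mp (h1.congr fun x => ?_)
  simp

theorem sumForm_freqIndicator (η : ℤ) (f : ℤ →₀ ℝ) :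
    sumForm (freqIndicator η) f f = ∑' x, f x * f (η - x) := by
  rw [tsum_eq_sum (s := f.support) fun x hx => by simp [Finsupp.notMem_support_iff.mp hx],
    sumForm_apply]
  refine Finset.sum_congr rfl fun x _ => ?_
  have h : ∀ y, (x + y = η) ↔ y = η - x := fun y => by lia
  simp only [freqIndicator, h]
  simp +contextual

section Limit

variable {f g : ℕ → ℤ →₀ ℝ}

/-- The limit of a stage sequence: the coefficient at `x` is final from stage `|x|` on. -/
noncomputable def limitCoeff (f : ℕ → ℤ →₀ ℝ) (x : ℤ) : ℝ := f x.natAbs x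

theorem IsStageSequence.apply_eq_limitCoeff (h : IsStageSequence f g) {n : ℕ} {x : ℤ}
    (hx : |x| ≤ n) : f n x = limitCoeff f x := by
  have hxa := Int.natCast_natAbs x
  obtain ⟨d, rfl⟩ := Nat.exists_eq_add_of_le (by lia : x.natAbs ≤ n)
  clear hx
  induction d with
  | zero => rfl
  | succ d ih => rw [← ih, ← add_assoc, h.stable _ x (Or.inr (by lia))]

theorem IsStageSequence.apply_eq_limitCoeff_of_ne (h : IsStageSequence f g) {n : ℕ} {x : ℤ}
    (hx : f n x ≠ 0) : f n x = limitCoeff f x := by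
  have h1 : ∀ d : ℕ, f (n + d) x = f n x := by
    intro d
    induction d with
    | zero => rfl
    | succ d ih => rw [← add_assoc, h.stable _ x (Or.inl (by rwa [ih])), ih]
  rw [← h1 x.natAbs]
  refine h.apply_eq_limitCoeff ?_
  rw [← Int.natCast_natAbs]
  lia

theorem IsStageSequence.abs_apply_le (h : IsStageSequence f g) (n : ℕ) (x : ℤ) :
    |f n x| ≤ |limitCoeff f x| := by
  by_cases hx : f n x = 0
  · simp [hx]
  · rw [h.apply_eq_limitCoeff_of_ne hx]

theorem IsStageSequence.tendsto_apply (h : IsStageSequence f g) (x : ℤ) :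
    Tendsto (fun n => f n x) atTop (𝓝 (limitCoeff f x)) :=
  tendsto_const_nhds.congr' (by
    filter_upwards [eventually_ge_atTop x.natAbs] with n hn
    exact (h.apply_eq_limitCoeff (by rw [← Int.natCast_natAbs]; lia)).symm)

/-- Each stage adds at least `1` to the mean of the square, which is the sum of the squared
coefficients. -/
theorem IsStageSequence.not_summable_sq (h : IsStageSequence f g) :
    ¬ Summable fun x => limitCoeff f x ^ 2 := by
  intro hs
  obtain ⟨n, hn⟩ := exists_nat_gt (∑' x, limitCoeff f x ^ 2)
  refine absurd ((h.stage n).mass) (not_le.mpr (lt_of_le_of_lt ?_ hn))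
  rw [sumForm_freqIndicator, tsum_eq_sum (s := (f n).support) fun x hx => by
    simp [Finsupp.notMem_support_iff.mp hx]]
  refine le_trans (Finset.sum_le_sum fun x _ => ?_)
    (hs.sum_le_tsum (f n).support fun x _ => sq_nonneg _)
  rw [zero_sub, (h.stage n).even, ← sq, sq_le_sq]
  exact h.abs_apply_le n x

theorem IsStageSequence.summable_weight (h : IsStageSequence f g) :
    Summable fun p : ℤ × ℤ =>
      |limitCoeff f p.1| * |limitCoeff f p.2| * freqWeight (p.1 + p.2) := by
  have hsum : Summable fun k : ℕ => 60 / ((k : ℝ) + 1) ^ 2 := by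
    have h1 := (summable_nat_add_iff 1).mpr
      (Real.summable_one_div_nat_pow.mpr (by norm_num : 1 < 2))
    refine (h1.mul_left 60).congr fun k => ?_
    push_cast
    ring
  refine summable_of_sum_le (c := ∑' k : ℕ, 60 / ((k : ℝ) + 1) ^ 2)
    (fun p => mul_nonneg (by positivity) (freqWeight_nonneg _)) fun T => ?_
  set n := T.sup fun p => max p.1.natAbs p.2.natAbs with hn
  have hT : ∀ p ∈ T, |p.1| ≤ n ∧ |p.2| ≤ n := fun p hp => by
    have := Finset.le_sup (f := fun p : ℤ × ℤ => max p.1.natAbs p.2.natAbs) hp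
    rw [← Int.natCast_natAbs, ← Int.natCast_natAbs]
    lia
  have hg0 : ∀ x, 0 ≤ g n x := fun x => (abs_nonneg _).trans ((h.stage n).le_majorant x)
  set s := (g n).support ∪ (T.image Prod.fst ∪ T.image Prod.snd) with hs
  calc ∑ p ∈ T, |limitCoeff f p.1| * |limitCoeff f p.2| * freqWeight (p.1 + p.2)
      ≤ ∑ p ∈ T, g n p.1 * (g n p.2 * freqWeight (p.1 + p.2)) := by
        refine Finset.sum_le_sum fun p hp => ?_
        rw [← h.apply_eq_limitCoeff (hT p hp).1, ← h.apply_eq_limitCoeff (hT p hp).2, mul_assoc]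
        have h1 := (h.stage n).le_majorant p.1
        have h2 := (h.stage n).le_majorant p.2
        have h3 := freqWeight_nonneg (p.1 + p.2)
        have h4 := hg0 p.1
        gcongr
    _ ≤ ∑ p ∈ s ×ˢ s, g n p.1 * (g n p.2 * freqWeight (p.1 + p.2)) := by
        refine Finset.sum_le_sum_of_subset_of_nonneg (fun p hp => ?_) fun p _ _ =>
          mul_nonneg (hg0 _) (mul_nonneg (hg0 _) (freqWeight_nonneg _))
        simp only [hs, Finset.mem_product, Finset.mem_union, Finset.mem_image]
        exact ⟨Or.inr (Or.inl ⟨p, hp, rfl⟩), Or.inr (Or.inr ⟨p, hp, rfl⟩)⟩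
    _ = sumForm freqWeight (g n) (g n) := by
        rw [Finset.sum_product, sumForm_apply_of_subset _ _ _ (s := s) (t := s)
          Finset.subset_union_left Finset.subset_union_left]
    _ ≤ ∑ k ∈ Finset.range n, 60 / ((k : ℝ) + 1) ^ 2 := (h.stage n).weight
    _ ≤ _ := hsum.sum_le_tsum _ fun k _ => by positivity

theorem IsStageSequence.limitCoeff_neg (h : IsStageSequence f g) (x : ℤ) :
    limitCoeff f (-x) = limitCoeff f x := by
  rw [limitCoeff, Int.natAbs_neg, (h.stage _).even, limitCoeff]

theorem IsStageSequence.isConvolutionSolution (h : IsStageSequence f g) :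
    IsConvolutionSolution (limitCoeff f) where
  sum_le_log N hN := by
    refine le_trans (Finset.sum_le_sum fun x hx => ?_) ((h.stage N).sum_le_log N hN)
    rw [Finset.mem_Icc] at hx
    rw [← h.apply_eq_limitCoeff (n := N) (by rw [abs_le]; lia)]
    exact (h.stage N).le_majorant x
  summable_weight := h.summable_weight
  hasSum_mul := by
    have hpos : ∀ k : ℕ, 1 ≤ k → HasSum (fun x => limitCoeff f x * limitCoeff f (k - x))
        (-(4 * Real.pi ^ 2 / 3) * k ^ 2 * limitCoeff f k) := by
      intro k hk
      have hs := summable_mul_of_summable_weight h.summable_weight (η := k) (by lia)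
      have h1 : Tendsto (fun n => ∑' x, f n x * f n (k - x)) atTop
          (𝓝 (∑' x, limitCoeff f x * limitCoeff f (k - x))) :=
        tendsto_tsum_of_dominated_convergence hs
          (fun x => (h.tendsto_apply x).mul (h.tendsto_apply (k - x)))
          (Eventually.of_forall fun n x => by
            rw [norm_mul]
            exact mul_le_mul (h.abs_apply_le n x) (h.abs_apply_le n (k - x)) (norm_nonneg _)
              (abs_nonneg _))
      have h2 : Tendsto (fun n => ∑' x, f n x * f n (k - x)) atTop
          (𝓝 (-(4 * Real.pi ^ 2 / 3) * k ^ 2 * limitCoeff f k)) := by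
        refine tendsto_const_nhds.congr' ?_
        filter_upwards [eventually_ge_atTop k] with n hn
        rw [← sumForm_freqIndicator, (h.stage n).equation k hk hn,
          h.apply_eq_limitCoeff (by rw [Nat.abs_cast]; exact_mod_cast hn)]
      rw [← tendsto_nhds_unique h1 h2]
      refine (Summable.of_norm ?_).hasSum
      simpa only [norm_mul, Real.norm_eq_abs] using hs
    intro η hη
    rcases lt_or_gt_of_ne hη with hneg | hpos'
    · obtain ⟨k, rfl⟩ : ∃ k : ℕ, η = -k := ⟨η.natAbs, by lia⟩
      have h1 := (Equiv.neg ℤ).hasSum_iff.mpr (hpos k (by lia))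
      rw [h.limitCoeff_neg, Int.cast_neg, neg_sq, Int.cast_natCast]
      refine h1.congr_fun ?_
      intro x
      simp only [Function.comp_apply, Equiv.neg_apply, h.limitCoeff_neg]
      rw [← h.limitCoeff_neg (k - -x)]
      congr 2
      ring
    · obtain ⟨k, rfl⟩ : ∃ k : ℕ, η = k := ⟨η.natAbs, by lia⟩
      exact_mod_cast hpos k (by lia)

end Limit

/-! ### The limiting function -/

instance UnitAddCircle.isProbabilityMeasure_volume :
    IsProbabilityMeasure (volume : Measure UnitAddCircle) :=
  ⟨UnitAddCircle.measure_univ⟩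

theorem eLpNorm_sub_le_of_geometric {α : Type*} {m : MeasurableSpace α} {μ : Measure α}
    {F : ℕ → α → ℝ} (hF : ∀ n, AEStronglyMeasurable (F n) μ) {q : ℝ≥0∞} (hq : 1 ≤ q) {n₀ : ℕ}
    (h : ∀ n, n₀ ≤ n → eLpNorm (F (n + 1) - F n) q μ ≤ 2⁻¹ ^ n) (d : ℕ) :
    ∀ n, n₀ ≤ n → eLpNorm (F (n + d) - F n) q μ ≤ 2 * 2⁻¹ ^ n := by
  induction d with
  | zero => simp
  | succ d ih =>
    intro n hn
    have e : F (n + (d + 1)) - F n = (F (n + 1 + d) - F (n + 1)) + (F (n + 1) - F n) := by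
      rw [show n + (d + 1) = n + 1 + d by ring]
      abel
    rw [e]
    calc _ ≤ _ := eLpNorm_add_le ((hF _).sub (hF _)) ((hF _).sub (hF _)) hq
      _ ≤ 2 * 2⁻¹ ^ (n + 1) + 2⁻¹ ^ n := add_le_add (ih (n + 1) (by lia)) (h n hn)
      _ = 2 * 2⁻¹ ^ n := by
        rw [pow_succ', ← mul_assoc, ENNReal.mul_inv_cancel (by simp) (by simp), one_mul, two_mul]

theorem continuous_memLp {F : UnitAddCircle → ℝ} (hF : Continuous F) (q : ℝ≥0∞) :
    MemLp F q volume := by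
  obtain ⟨C, hC⟩ := (isCompact_range hF).isBounded.exists_norm_le
  exact MemLp.of_bound hF.aestronglyMeasurable C (ae_of_all _ fun x => hC _ ⟨x, rfl⟩)

theorem tendsto_fourierCoeff_of_eLpNorm_one {F : ℕ → UnitAddCircle → ℝ} {u : UnitAddCircle → ℝ}
    (hF : ∀ n, MemLp (F n) 1 volume) (hu : MemLp u 1 volume)
    (h : Tendsto (fun n => eLpNorm (F n - u) 1 volume) atTop (𝓝 0)) (ξ : ℤ) :
    Tendsto (fun n => fourierCoeff (fun x => (F n x : ℂ)) ξ) atTop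
      (𝓝 (fourierCoeff (fun x => (u x : ℂ)) ξ)) := by
  unfold fourierCoeff
  rw [← UnitAddCircle.volume_eq_haar]
  have hint : ∀ {v : UnitAddCircle → ℝ}, MemLp v 1 volume →
      Integrable (fun x => fourier (-ξ) x • (v x : ℂ)) volume := fun {v} hv => by
    have h1 : Integrable (fun x => (v x : ℂ)) AddCircle.haarAddCircle := by
      rw [← UnitAddCircle.volume_eq_haar]
      exact (memLp_one_iff_integrable.mp hv).ofReal
    rw [UnitAddCircle.volume_eq_haar]
    exact h1.fourier_smul _
  refine tendsto_integral_of_L1' _ (hint hu).aestronglyMeasurable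
    (Eventually.of_forall fun n => hint (hF n)) (h.congr fun n => ?_)
  refine eLpNorm_congr_norm_ae (ae_of_all _ fun x => ?_)
  rw [Pi.sub_apply, Pi.sub_apply, ← smul_sub, norm_smul, fourier_apply, Circle.norm_coe, one_mul,
    ← Complex.ofReal_sub, Complex.norm_real]

theorem not_memLp_two_of_not_summable {u : UnitAddCircle → ℝ} {c : ℤ → ℝ}
    (hc : ∀ ξ, fourierCoeff (fun x => (u x : ℂ)) ξ = c ξ) (hs : ¬ Summable fun ξ => c ξ ^ 2) :
    ¬ MemLp u 2 volume := by
  intro hu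
  have h1 : MemLp (fun x => (u x : ℂ)) 2 AddCircle.haarAddCircle := by
    rw [← UnitAddCircle.volume_eq_haar]
    exact hu.ofReal
  have h2 := (hasSum_sq_fourierCoeff h1.toLp).summable
  rw [fourierCoeff_congr_ae h1.coeFn_toLp] at h2
  exact hs (h2.congr fun ξ => by rw [hc, Complex.norm_real, Real.norm_eq_abs, sq_abs])

theorem IsStageSequence.exists_limit {f g : ℕ → ℤ →₀ ℝ} (h : IsStageSequence f g) :
    ∃ u : UnitAddCircle → ℝ, (∀ ε : ℝ, 0 < ε → ε < 1 → MemLp u (ENNReal.ofReal (2 - ε)) volume) ∧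
      ∀ ξ, fourierCoeff (fun x => (u x : ℂ)) ξ = limitCoeff f ξ := by
  set F : ℕ → UnitAddCircle → ℝ := fun n => trigFun (f n)
  have hFm : ∀ n, AEStronglyMeasurable (F n) volume := fun n =>
    (continuous_trigFun (f n)).aestronglyMeasurable
  have hFL : ∀ n q, MemLp (F n) q volume := fun n q => continuous_memLp (continuous_trigFun (f n)) q
  -- for fixed `ε`, all but finitely many increments are small in `L^{2-ε}`
  have hinc : ∀ ε : ℝ, 0 < ε → ε ≤ 1 → ∃ n₀ : ℕ, (ε = 1 → n₀ = 0) ∧ ∀ n, n₀ ≤ n →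
      eLpNorm (F (n + 1) - F n) (ENNReal.ofReal (2 - ε)) volume ≤ 2⁻¹ ^ n := by
    intro ε hε hε1
    obtain ⟨n₀, hn₀, hn₀'⟩ : ∃ n₀ : ℕ, 1 / ε ≤ n₀ + 1 ∧ (ε = 1 → n₀ = 0) := by
      by_cases h1 : ε = 1
      · exact ⟨0, by simp [h1], fun _ => rfl⟩
      · obtain ⟨m, hm⟩ := exists_nat_ge (1 / ε)
        exact ⟨m, by linarith, fun h2 => absurd h2 h1⟩
    refine ⟨n₀, hn₀', fun n hn => le_trans ?_ (h.small n)⟩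
    refine eLpNorm_le_eLpNorm_of_exponent_le ?_ ((hFm _).sub (hFm _))
    refine ENNReal.ofReal_le_ofReal (sub_le_sub_left ?_ 2)
    have h1 : (n₀ : ℝ) ≤ n := by exact_mod_cast hn
    rw [div_le_iff₀ (by positivity)]
    rw [div_le_iff₀ hε] at hn₀
    nlinarith
  have hone : ∀ n d, eLpNorm (F (n + d) - F n) 1 volume ≤ 2 * 2⁻¹ ^ n := fun n d => by
    obtain ⟨n₀, h1, h2⟩ := hinc 1 one_pos le_rfl
    have e : ENNReal.ofReal (2 - 1) = 1 := by norm_num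
    rw [e] at h2
    exact eLpNorm_sub_le_of_geometric hFm le_rfl h2 d n (by rw [h1 rfl]; exact Nat.zero_le n)
  obtain ⟨u, huL, hlim⟩ := Lp.cauchy_complete_eLpNorm (p := 1) (μ := volume) le_rfl
    (f := F) (fun n => hFL n 1) (B := fun n => 4 * 2⁻¹ ^ n)
    (by
      rw [ENNReal.tsum_mul_left, ENNReal.tsum_geometric]
      exact ENNReal.mul_ne_top (by simp) (by simp))
    (by
      intro N n m hn hm
      have key : ∀ a b : ℕ, N ≤ a → a ≤ b → eLpNorm (F b - F a) 1 volume < 4 * 2⁻¹ ^ N := by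
        intro a b ha hab
        obtain ⟨d, rfl⟩ := Nat.exists_eq_add_of_le hab
        refine (hone a d).trans_lt ?_
        calc (2 : ℝ≥0∞) * 2⁻¹ ^ a ≤ 2 * 2⁻¹ ^ N :=
              mul_le_mul_right (pow_le_pow_of_le_one (by simp) (by simp) ha) 2
          _ < 4 * 2⁻¹ ^ N := by
              refine ENNReal.mul_lt_mul_left (by simp) (by simp) (by norm_num)
      rcases le_total n m with hnm | hnm
      · rw [eLpNorm_sub_comm]
        exact key n m hn hnm
      · exact key m n hm hnm)
  refine ⟨u, fun ε hε hε1 => ⟨huL.1, ?_⟩, fun ξ => ?_⟩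
  · have hq : 1 ≤ ENNReal.ofReal (2 - ε) := by
      rw [ENNReal.one_le_ofReal]
      linarith
    obtain ⟨n₀, -, hn₀⟩ := hinc ε hε hε1.le
    obtain ⟨ns, hns, hae⟩ := (tendstoInMeasure_of_tendsto_eLpNorm one_ne_zero hFm huL.1
      hlim).exists_seq_tendsto_ae
    refine (Lp.eLpNorm_le_of_ae_tendsto (u := atTop)
      (C := 2 * 2⁻¹ ^ n₀ + eLpNorm (F n₀) (ENNReal.ofReal (2 - ε)) volume) ?_
      (fun n => hFm (ns n)) hae).trans_lt ?_
    · filter_upwards [eventually_ge_atTop n₀] with k hk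
      obtain ⟨d, hd⟩ := Nat.exists_eq_add_of_le (hk.trans hns.le_apply)
      have e : F (ns k) = (F (n₀ + d) - F n₀) + F n₀ := by rw [hd]; abel
      rw [e]
      refine (eLpNorm_add_le ((hFm _).sub (hFm _)) (hFm _) hq).trans (add_le_add_left ?_ _)
      exact eLpNorm_sub_le_of_geometric hFm hq hn₀ d n₀ le_rfl
    · exact ENNReal.add_lt_top.mpr ⟨ENNReal.mul_lt_top (by simp) (by simp), (hFL _ _).2⟩
  · refine tendsto_nhds_unique
      (tendsto_fourierCoeff_of_eLpNorm_one (fun n => hFL n 1) huL hlim ξ) ?_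
    refine ((Complex.continuous_ofReal.tendsto _).comp (h.tendsto_apply ξ)).congr fun n => ?_
    have e : (fun x => (F n x : ℂ)) = trigPoly (f n) := by
      funext x
      exact ofReal_trigFun (h.stage n).even x
    rw [e, fourierCoeff_trigPoly, Function.comp_apply]

/-! ### Derivatives, Littlewood-Paley blocks and Sobolev norms on the torus -/

theorem torusDeriv_coe (ψ : UnitAddCircle → ℂ) (t : ℝ) :
    torusDeriv ψ (t : UnitAddCircle) = deriv (fun t : ℝ => ψ (t : UnitAddCircle)) t := by
  have h := deriv_comp_const_add (f := fun t : ℝ => ψ (t : UnitAddCircle)) t 0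
  rw [add_zero] at h
  rw [← h, torusDeriv]
  simp only [AddCircle.coe_add]

theorem TorusSmooth.torusDeriv {ψ : UnitAddCircle → ℂ} (h : TorusSmooth ψ) :
    TorusSmooth (torusDeriv ψ) := by
  unfold TorusSmooth
  simp only [torusDeriv_coe]
  exact (contDiff_infty_iff_deriv.mp h).2

theorem TorusSmooth.fourierCoeff_torusDeriv {ψ : UnitAddCircle → ℂ} (h : TorusSmooth ψ) (n : ℤ) :
    fourierCoeff (_root_.torusDeriv ψ) n = 2 * Real.pi * Complex.I * n * fourierCoeff ψ n := by
  have hd : ∀ t : ℝ, HasDerivAt (fun t : ℝ => ψ (t : UnitAddCircle))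
      (deriv (fun t : ℝ => ψ (t : UnitAddCircle)) t) t := fun t =>
    ((contDiff_infty_iff_deriv.mp h).1 t).hasDerivAt
  have hc : Continuous (deriv fun t : ℝ => ψ (t : UnitAddCircle)) :=
    (contDiff_infty_iff_deriv.mp h).2.continuous
  have he : Continuous fun t : ℝ => (fourier (-n) (t : UnitAddCircle) : ℂ) :=
    (fourier (-n)).continuous.comp (AddCircle.continuous_mk' 1)
  have hparts := intervalIntegral.integral_mul_deriv_eq_deriv_mul (a := 0) (b := 1)
    (fun t _ => hasDerivAt_fourier_neg 1 n t) (fun t _ => hd t)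
    ((continuous_const.mul he).intervalIntegrable _ _) (hc.intervalIntegrable _ _)
  rw [fourierCoeff_eq_intervalIntegral _ n 0, fourierCoeff_eq_intervalIntegral _ n 0]
  simp only [torusDeriv_coe, smul_eq_mul, zero_add]
  rw [hparts]
  have h10 : ((1 : ℝ) : UnitAddCircle) = ((0 : ℝ) : UnitAddCircle) := by
    rw [AddCircle.coe_period, AddCircle.coe_zero]
  rw [h10, sub_self, zero_sub]
  simp only [Complex.ofReal_one, div_one, mul_assoc, intervalIntegral.integral_const_mul, one_smul]
  ring

theorem fourierCoeff_fourier_mul (g : UnitAddCircle → ℂ) (ξ η : ℤ) :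
    fourierCoeff (fun x => fourier ξ x * g x) η = fourierCoeff g (η - ξ) := by
  unfold fourierCoeff
  refine integral_congr_ae (ae_of_all _ fun x => ?_)
  simp only [smul_eq_mul]
  rw [← mul_assoc, ← fourier_add, neg_sub, neg_add_eq_sub]

theorem fourierCoeff_trigPoly_mul (a b : ℤ →₀ ℝ) (η : ℤ) :
    fourierCoeff (fun x => trigPoly a x * trigPoly b x) η = ((∑' ξ, a ξ * b (η - ξ) : ℝ) : ℂ) := by
  have h : (fun x => trigPoly a x * trigPoly b x) =
      ∑ ξ ∈ a.support, fun x => (a ξ : ℂ) * (fourier ξ x * trigPoly b x) := by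
    funext x
    simp only [trigPoly_apply a, Finset.sum_apply, Finset.sum_mul, mul_assoc]
  rw [h, fourierCoeff.sum]
  · rw [tsum_eq_sum (s := a.support) fun x hx => by simp [Finsupp.notMem_support_iff.mp hx]]
    push_cast
    rw [Finset.sum_apply]
    refine Finset.sum_congr rfl fun ξ _ => ?_
    rw [fourierCoeff.const_mul, fourierCoeff_fourier_mul, fourierCoeff_trigPoly]
  · intro ξ _
    exact (continuous_const.mul ((fourier ξ).continuous.mul
      (trigPoly b).continuous)).integrable_of_hasCompactSupport
      (HasCompactSupport.of_compactSpace _)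

section LittlewoodPaley

variable {φ : ℝ → ℝ}

theorem IsLPProfile.bounds_of_ne_zero (hφ : IsLPProfile φ) {x : ℝ} (hx : φ x ≠ 0) :
    6 / 7 ≤ |x| ∧ |x| ≤ 2 :=
  hφ.tsupport_subset (subset_tsupport _ hx)

theorem IsLPProfile.mem_Icc_of_ne_zero (hφ : IsLPProfile φ) {j : ℕ} {ξ : ℤ}
    (h : φ ((ξ : ℝ) / 2 ^ j) ≠ 0) :
    ξ ∈ Finset.Icc (-((2 ^ (j + 1) : ℕ) : ℤ)) ((2 ^ (j + 1) : ℕ) : ℤ) := by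
  have h1 := (hφ.bounds_of_ne_zero h).2
  rw [abs_div, abs_of_pos (by positivity : (0 : ℝ) < 2 ^ j), div_le_iff₀ (by positivity)] at h1
  have h2 : |ξ| ≤ ((2 ^ (j + 1) : ℕ) : ℤ) := by
    have : |(ξ : ℝ)| ≤ ((2 ^ (j + 1) : ℕ) : ℝ) := by
      push_cast
      rw [pow_succ']
      exact h1
    exact_mod_cast this
  rw [Finset.mem_Icc]
  exact abs_le.mp h2

/-- The coefficients of the `j`-th Littlewood-Paley block of a real sequence. -/
noncomputable def lpCoeff (hφ : IsLPProfile φ) (c : ℤ → ℝ) (j : ℕ) : ℤ →₀ ℝ :=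
  Finsupp.onFinset (Finset.Icc (-((2 ^ (j + 1) : ℕ) : ℤ)) ((2 ^ (j + 1) : ℕ) : ℤ))
    (fun ξ => c ξ * φ ((ξ : ℝ) / 2 ^ j)) fun _ h => hφ.mem_Icc_of_ne_zero (right_ne_zero_of_mul h)

theorem lpBlock_eq_trigPoly (hφ : IsLPProfile φ) {c : ℤ → ℝ} {f : TorusDistribution}
    (hf : ∀ ξ, f.coeff ξ = c ξ) (j : ℕ) : lpBlock φ j f = trigPoly (lpCoeff hφ c j) := by
  funext x
  rw [trigPoly_apply, lpBlock, tsum_eq_sum (s := (lpCoeff hφ c j).support)]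
  · simp [lpCoeff, hf]
  · intro ξ hξ
    have h := Finsupp.notMem_support_iff.mp hξ
    rw [lpCoeff, Finsupp.onFinset_apply] at h
    rw [hf, ← Complex.ofReal_mul, h, Complex.ofReal_zero, zero_mul]

theorem eLpNorm_lpBlock_top_le (hφ : IsLPProfile φ) {c : ℤ → ℝ} {f : TorusDistribution}
    (hf : ∀ ξ, f.coeff ξ = c ξ)
    (hlog : ∀ N : ℕ, 1 ≤ N → ∑ x ∈ Finset.Icc (-N : ℤ) N, |c x| ≤ Real.log N) (j : ℕ) :
    eLpNorm (lpBlock φ j f) ⊤ volume ≤ ENNReal.ofReal (j + 1) := by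
  rw [eLpNorm_exponent_top]
  refine eLpNormEssSup_le_of_ae_bound (ae_of_all _ fun x => ?_)
  rw [lpBlock_eq_trigPoly hφ hf, trigPoly_apply]
  have h1 : ∑ ξ ∈ (lpCoeff hφ c j).support, ‖((lpCoeff hφ c j ξ : ℝ) : ℂ) * fourier ξ x‖ =
      l1Norm (lpCoeff hφ c j) := by
    refine Finset.sum_congr rfl fun ξ _ => ?_
    rw [norm_mul, fourier_apply, Circle.norm_coe, mul_one, Complex.norm_real, Real.norm_eq_abs]
  refine (norm_sum_le _ _).trans (h1.le.trans ?_)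
  calc l1Norm (lpCoeff hφ c j)
      = ∑ x ∈ Finset.Icc (-((2 ^ (j + 1) : ℕ) : ℤ)) ((2 ^ (j + 1) : ℕ) : ℤ), |lpCoeff hφ c j x| :=
        l1Norm_eq_of_subset _ Finsupp.support_onFinset_subset
    _ ≤ ∑ x ∈ Finset.Icc (-((2 ^ (j + 1) : ℕ) : ℤ)) ((2 ^ (j + 1) : ℕ) : ℤ), |c x| := by
        refine Finset.sum_le_sum fun ξ _ => ?_
        rw [lpCoeff, Finsupp.onFinset_apply, abs_mul]
        refine mul_le_of_le_one_right (abs_nonneg _) ?_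
        rw [abs_of_nonneg (hφ.mem_Icc _).1]
        exact (hφ.mem_Icc _).2
    _ ≤ Real.log (2 ^ (j + 1) : ℕ) := hlog _ Nat.one_le_two_pow
    _ = (j + 1) * Real.log 2 := by
        push_cast
        rw [Real.log_pow]
        push_cast
        ring
    _ ≤ j + 1 := by
        have := Real.log_two_lt_d9
        exact mul_le_of_le_one_right (by positivity) (by linarith)

/-- Logarithmic growth of the partial `ℓ¹` sums gives membership in all Besov spaces of negative
order. -/
theorem memBesovInfty_of_sum_le_log (hφ : IsLPProfile φ) {c : ℤ → ℝ} {f : TorusDistribution}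
    (hf : ∀ ξ, f.coeff ξ = c ξ)
    (hlog : ∀ N : ℕ, 1 ≤ N → ∑ x ∈ Finset.Icc (-N : ℤ) N, |c x| ≤ Real.log N) {ε : ℝ} (hε : 0 < ε)
    (hε1 : ε < 1) : MemBesovInfty φ (-ε) f := by
  refine (iSup_le fun j => ?_ : _ ≤ ENNReal.ofReal (1 / (ε * Real.log 2))).trans_lt
    ENNReal.ofReal_lt_top
  refine (mul_le_mul_right (eLpNorm_lpBlock_top_le hφ hf hlog j) _).trans ?_
  rw [← ENNReal.ofReal_mul (by positivity)]
  refine ENNReal.ofReal_le_ofReal ?_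
  have hl := Real.log_pos one_lt_two
  have hl1 := Real.log_two_lt_d9
  -- Bernoulli's inequality absorbs the factor `j + 1`
  have h1 : j * (ε * Real.log 2) + 1 ≤ (2 : ℝ) ^ (j * ε) := by
    rw [Real.rpow_def_of_pos two_pos]
    convert Real.add_one_le_exp _ using 2
    ring
  rw [mul_neg, Real.rpow_neg two_pos.le, inv_mul_eq_div, div_le_div_iff₀ (by positivity)
    (by positivity)]
  nlinarith

/-- The `ℓ²` norm is at most the `ℓ¹` norm. -/
theorem TorusDistribution.hdotNorm_le_tsum (s : ℝ) (f : TorusDistribution) :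
    f.hdotNorm s ≤ ∑' ξ : {ξ : ℤ // ξ ≠ 0},
      ENNReal.ofReal (|((ξ : ℤ) : ℝ)| ^ s * ‖f.coeff (ξ : ℤ)‖) := by
  set a : {ξ : ℤ // ξ ≠ 0} → ℝ≥0∞ := fun ξ =>
    ENNReal.ofReal (|((ξ : ℤ) : ℝ)| ^ s * ‖f.coeff (ξ : ℤ)‖) with ha
  have h1 : ∀ ξ : {ξ : ℤ // ξ ≠ 0},
      ENNReal.ofReal (|((ξ : ℤ) : ℝ)| ^ (2 * s) * ‖f.coeff (ξ : ℤ)‖ ^ 2) = a ξ * a ξ := by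
    intro ξ
    rw [ha, ← ENNReal.ofReal_mul (by positivity)]
    congr 1
    rw [two_mul, Real.rpow_add (by simpa using ξ.2)]
    ring
  have h2 : ∑' ξ, a ξ * a ξ ≤ (∑' ξ, a ξ) * ∑' ξ, a ξ := by
    rw [← ENNReal.tsum_mul_right]
    exact ENNReal.tsum_le_tsum fun ξ => mul_le_mul_right (ENNReal.le_tsum ξ) _
  rw [hdotNorm]
  simp only [h1]
  refine (ENNReal.rpow_le_rpow h2 (by norm_num)).trans_eq ?_
  rw [ENNReal.mul_rpow_of_nonneg _ _ (by norm_num), ← ENNReal.rpow_add_of_nonneg _ _ (by norm_num)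
    (by norm_num)]
  norm_num

end LittlewoodPaley

/-! ### The paraproduct -/

section Paraproduct

variable {φ : ℝ → ℝ}

/-- The contribution of the frequencies `ξ` and `η - ξ` to the coefficient at `η` of the product of
the Littlewood-Paley blocks with indices `p.1` and `p.2`. -/
noncomputable def paraCoeff (φ : ℝ → ℝ) (c : ℤ → ℝ) (p : ℕ × ℕ) (η ξ : ℤ) : ℝ :=
  c ξ * φ ((ξ : ℝ) / 2 ^ p.1) * (c (η - ξ) * φ (((η - ξ : ℤ) : ℝ) / 2 ^ p.2))

theorem coeff_paraTerm (hφ : IsLPProfile φ) {c : ℤ → ℝ} {f : TorusDistribution}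
    (hf : ∀ ξ, f.coeff ξ = c ξ) (p : ℕ × ℕ) {η : ℤ} (hη : η ≠ 0) :
    (paraTerm φ f f p).coeff η = ((∑' ξ, paraCoeff φ c p η ξ : ℝ) : ℂ) := by
  have h := fourierCoeff_trigPoly_mul (lpCoeff hφ c p.1) (lpCoeff hφ c p.2) η
  simp only [paraTerm, TorusDistribution.meanFree, TorusDistribution.coeff, if_neg hη,
    TorusDistribution.ofFun, lpBlock_eq_trigPoly hφ hf]
  rw [h]
  simp only [lpCoeff, Finsupp.onFinset_apply, paraCoeff]

theorem IsLPProfile.hasSum_of_ne_zero (hφ : IsLPProfile φ) {ξ : ℤ} (hξ : ξ ≠ 0) :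
    HasSum (fun j : ℕ => φ ((ξ : ℝ) / 2 ^ j)) 1 :=
  hφ.hasSum_one ξ (by exact_mod_cast Int.one_le_abs hξ)

theorem hasSum_paraCoeff (hφ : IsLPProfile φ) {c : ℤ → ℝ} (hc : c 0 = 0) (η ξ : ℤ) :
    HasSum (fun p => paraCoeff φ c p η ξ) (c ξ * c (η - ξ)) := by
  have h1 : ∀ ζ : ℤ, HasSum (fun j : ℕ => c ζ * φ ((ζ : ℝ) / 2 ^ j)) (c ζ) := by
    intro ζ
    rcases eq_or_ne ζ 0 with rfl | hζ
    · simp [hc]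
    · simpa using (hφ.hasSum_of_ne_zero hζ).mul_left (c ζ)
  have h2 := summable_mul_of_summable_norm (h1 ξ).summable.norm (h1 (η - ξ)).summable.norm
  have h3 := (h1 ξ).mul (h1 (η - ξ)) h2
  simpa only [paraCoeff] using h3

theorem tsum_ofReal_abs_paraCoeff_le (hφ : IsLPProfile φ) {c : ℤ → ℝ} (hc : c 0 = 0) (η ξ : ℤ) :
    ∑' p, ENNReal.ofReal |paraCoeff φ c p η ξ| ≤ ENNReal.ofReal (|c ξ| * |c (η - ξ)|) := by
  have h := hasSum_paraCoeff hφ (c := fun ζ => |c ζ|) (by simp [hc]) η ξ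
  have e : ∀ p, |paraCoeff φ c p η ξ| = paraCoeff φ (fun ζ => |c ζ|) p η ξ := fun p => by
    simp only [paraCoeff, abs_mul, abs_of_nonneg (hφ.mem_Icc _).1]
  simp only [e]
  rw [← ENNReal.ofReal_tsum_of_nonneg (fun p => (abs_nonneg _).trans_eq (e p)) h.summable,
    h.tsum_eq]

/-- The sum of the absolute values of all contributions to the coefficient at `η` of the
paraproduct term with indices `p`, weighted by `|η|^{-5}`. It dominates the `p`-th term in
`Ḣ^{-5}`, summed over `η`. -/
noncomputable def paraMass (φ : ℝ → ℝ) (c : ℤ → ℝ) (p : ℕ × ℕ) (η : ℤ) : ℝ≥0∞ :=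
  ENNReal.ofReal (freqWeight η) * ∑' ξ, ENNReal.ofReal |paraCoeff φ c p η ξ|

theorem tsum_weight_lt_top {c : ℤ → ℝ}
    (h : Summable fun p : ℤ × ℤ => |c p.1| * |c p.2| * freqWeight (p.1 + p.2)) :
    ∑' η, ENNReal.ofReal (freqWeight η) * ∑' ξ, ENNReal.ofReal (|c ξ| * |c (η - ξ)|) < ⊤ := by
  -- the change of variables `(η, ξ) ↦ (ξ, η - ξ)`
  let e : ℤ × ℤ ≃ ℤ × ℤ :=
    { toFun := fun p => (p.2, p.1 - p.2)
      invFun := fun p => (p.1 + p.2, p.1)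
      left_inv := fun p => by simp
      right_inv := fun p => by simp }
  have h1 := (e.summable_iff.mpr h).tsum_ofReal_lt_top
  rw [ENNReal.tsum_prod' (f := fun p : ℤ × ℤ => ENNReal.ofReal _)] at h1
  refine lt_of_le_of_lt (ENNReal.tsum_le_tsum fun η => ?_) h1
  rw [← ENNReal.tsum_mul_left]
  refine ENNReal.tsum_le_tsum fun ξ => ?_
  rw [← ENNReal.ofReal_mul (freqWeight_nonneg η)]
  refine ENNReal.ofReal_le_ofReal (le_of_eq ?_)
  simp only [Function.comp_apply, e, Equiv.coe_fn_mk, add_sub_cancel]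
  ring

theorem IsConvolutionSolution.apply_zero {c : ℤ → ℝ} (h : IsConvolutionSolution c) : c 0 = 0 := by
  have h1 := h.sum_le_log 1 le_rfl
  rw [Nat.cast_one (R := ℝ), Real.log_one] at h1
  have h2 := Finset.single_le_sum (f := fun x => |c x|) (fun x _ => abs_nonneg _)
    (by simp : (0 : ℤ) ∈ Finset.Icc (-((1 : ℕ) : ℤ)) ((1 : ℕ) : ℤ))
  exact abs_nonpos_iff.mp (h2.trans h1)

theorem IsConvolutionSolution.tsum_paraMass_lt_top (hφ : IsLPProfile φ) {c : ℤ → ℝ}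
    (h : IsConvolutionSolution c) : ∑' p, ∑' η, paraMass φ c p η < ⊤ := by
  refine lt_of_le_of_lt ?_ (tsum_weight_lt_top h.summable_weight)
  rw [ENNReal.tsum_comm]
  refine ENNReal.tsum_le_tsum fun η => ?_
  simp only [paraMass]
  rw [ENNReal.tsum_mul_left, ENNReal.tsum_comm]
  gcongr with ξ
  exact tsum_ofReal_abs_paraCoeff_le hφ h.apply_zero η ξ

theorem hdotNorm_le_tsum_freqWeight {s : ℝ} (hs : 5 ≤ s) {f : TorusDistribution} {m : ℤ → ℝ≥0∞}
    (h : ∀ η : ℤ, η ≠ 0 → ENNReal.ofReal (freqWeight η) * ‖f.coeff η‖ₑ ≤ m η) :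
    f.hdotNorm (-s) ≤ ∑' η, m η := by
  refine (f.hdotNorm_le_tsum (-s)).trans ((ENNReal.tsum_le_tsum fun η => ?_).trans
    (ENNReal.tsum_comp_le_tsum_of_injective Subtype.val_injective m))
  refine le_trans ?_ (h η η.2)
  rw [← ofReal_norm, ← ENNReal.ofReal_mul (freqWeight_nonneg _)]
  refine ENNReal.ofReal_le_ofReal ?_
  gcongr
  have h1 : (1 : ℝ) ≤ |((η : ℤ) : ℝ)| := by exact_mod_cast Int.one_le_abs η.2
  rw [freqWeight, ← Real.rpow_natCast, ← Real.rpow_neg (by positivity)]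
  exact Real.rpow_le_rpow_of_exponent_le h1 (by push_cast; linarith)

theorem IsConvolutionSolution.summable_paraCoeff (hφ : IsLPProfile φ) {c : ℤ → ℝ}
    (h : IsConvolutionSolution c) {η : ℤ} (hη : η ≠ 0) :
    Summable fun q : ℤ × (ℕ × ℕ) => paraCoeff φ c q.2 η q.1 := by
  have h1 : ∑' q : ℤ × (ℕ × ℕ), ENNReal.ofReal |paraCoeff φ c q.2 η q.1| ≠ ⊤ := by
    rw [ENNReal.tsum_prod (f := fun ξ p => ENNReal.ofReal |paraCoeff φ c p η ξ|)]
    refine ne_top_of_le_ne_top ?_ (ENNReal.tsum_le_tsum fun ξ =>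
      tsum_ofReal_abs_paraCoeff_le hφ h.apply_zero η ξ)
    exact (summable_mul_of_summable_weight h.summable_weight hη).tsum_ofReal_ne_top
  refine Summable.of_norm ?_
  have h2 := ENNReal.summable_toReal h1
  refine h2.congr fun q => ?_
  rw [ENNReal.toReal_ofReal (abs_nonneg _), Real.norm_eq_abs]

/-- At each nonzero frequency the paraproduct terms sum to the convolution, by Fubini. -/
theorem IsConvolutionSolution.hasSum_tsum_paraCoeff (hφ : IsLPProfile φ) {c : ℤ → ℝ}
    (h : IsConvolutionSolution c) {η : ℤ} (hη : η ≠ 0) :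
    HasSum (fun p => ∑' ξ, paraCoeff φ c p η ξ) (-(4 * Real.pi ^ 2 / 3) * η ^ 2 * c η) := by
  have h1 := h.summable_paraCoeff hφ hη
  have h2 := h1.hasSum.prod_fiberwise fun ξ => hasSum_paraCoeff hφ h.apply_zero η ξ
  rw [(h.hasSum_mul η hη).unique h2]
  have h3 := (Equiv.prodComm (ℕ × ℕ) ℤ).hasSum_iff.mpr h1.hasSum
  exact h3.prod_fiberwise fun p => (h3.summable.prod_factor p).hasSum

theorem paraproductWellDefined_of_isConvolutionSolution (hφ : IsLPProfile φ) {c : ℤ → ℝ}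
    (h : IsConvolutionSolution c) {f : TorusDistribution} (hf : ∀ ξ, f.coeff ξ = c ξ) {s : ℝ}
    (hs : 5 ≤ s) : ParaproductWellDefined φ (-s) f f := by
  refine lt_of_le_of_lt (ENNReal.tsum_le_tsum fun p => ?_) (h.tsum_paraMass_lt_top hφ)
  refine hdotNorm_le_tsum_freqWeight hs fun η hη => ?_
  rw [coeff_paraTerm hφ hf p hη, paraMass]
  gcongr
  rw [← ofReal_norm, Complex.norm_real, ofReal_norm]
  refine enorm_tsum_le_tsum_enorm.trans_eq ?_
  simp only [← ofReal_norm, Real.norm_eq_abs]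

/-- The distribution `u'' / 3` in terms of the coefficients `c` of `u`. -/
noncomputable def thirdSecondDeriv {c : ℤ → ℝ} (f : TorusDistribution) (hf : ∀ ξ, f.coeff ξ = c ξ) :
    TorusDistribution :=
  ⟨fun η => ((-(4 * Real.pi ^ 2 / 3) * η ^ 2 * c η : ℝ) : ℂ), by
    obtain ⟨C, N, h⟩ := f.2
    refine ⟨4 * Real.pi ^ 2 / 3 * C, N + 2, fun η => ?_⟩
    have h1 : |c η| ≤ C * (1 + |(η : ℝ)|) ^ N := by
      have h2 := h η
      rw [show f.1 η = c η from hf η, Complex.norm_real] at h2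
      exact h2
    have h3 : |(η : ℝ)| ^ 2 * |c η| ≤ C * (1 + |(η : ℝ)|) ^ (N + 2) :=
      calc |(η : ℝ)| ^ 2 * |c η| ≤ (1 + |(η : ℝ)|) ^ 2 * (C * (1 + |(η : ℝ)|) ^ N) := by
            gcongr
            linarith
        _ = C * (1 + |(η : ℝ)|) ^ (N + 2) := by ring
    rw [Complex.norm_real, Real.norm_eq_abs, abs_mul, abs_mul, abs_neg,
      abs_of_nonneg (by positivity : 0 ≤ 4 * Real.pi ^ 2 / 3), abs_pow, mul_assoc, mul_assoc]
    exact mul_le_mul_of_nonneg_left h3 (by positivity)⟩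

theorem isParaproduct_thirdSecondDeriv (hφ : IsLPProfile φ) {c : ℤ → ℝ}
    (h : IsConvolutionSolution c) {f : TorusDistribution} (hf : ∀ ξ, f.coeff ξ = c ξ) :
    IsParaproduct φ (-5) f f (thirdSecondDeriv f hf) := by
  refine ⟨paraproductWellDefined_of_isConvolutionSolution hφ h hf le_rfl, ?_, ?_, ?_⟩
  · refine lt_of_le_of_lt (hdotNorm_le_tsum_freqWeight le_rfl fun η hη => ?_)
      (tsum_weight_lt_top h.summable_weight)
    change _ * ‖((-(4 * Real.pi ^ 2 / 3) * η ^ 2 * c η : ℝ) : ℂ)‖ₑ ≤ _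
    gcongr
    rw [← ofReal_norm, Complex.norm_real, ofReal_norm, ← (h.hasSum_mul η hη).tsum_eq]
    refine enorm_tsum_le_tsum_enorm.trans_eq ?_
    simp only [← ofReal_norm, Real.norm_eq_abs, abs_mul]
  · simp [TorusDistribution.coeff, thirdSecondDeriv]
  · have h0 := ENNReal.tendsto_tsum_compl_atTop_zero (h.tsum_paraMass_lt_top hφ).ne
    refine tendsto_of_tendsto_of_tendsto_of_le_of_le tendsto_const_nhds h0 (fun _ => zero_le)
      fun F => ?_
    refine (hdotNorm_le_tsum_freqWeight (m := fun η => ∑' p : {p // p ∉ F}, paraMass φ c p η)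
      le_rfl fun η hη => ?_).trans_eq ENNReal.tsum_comm
    have hs := h.hasSum_tsum_paraCoeff hφ hη
    have e : (thirdSecondDeriv f hf - ∑ p ∈ F, paraTerm φ f f p).coeff η =
        ((∑' p : {p // p ∉ F}, ∑' ξ, paraCoeff φ c p η ξ : ℝ) : ℂ) := by
      have e1 : (thirdSecondDeriv f hf - ∑ p ∈ F, paraTerm φ f f p).coeff η =
          (thirdSecondDeriv f hf).coeff η - ∑ p ∈ F, (paraTerm φ f f p).coeff η := by
        simp [TorusDistribution.coeff]
      have e2 := hs.summable.sum_add_tsum_subtype_compl F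
      rw [hs.tsum_eq] at e2
      rw [e1, Finset.sum_congr rfl fun p _ => coeff_paraTerm hφ hf p hη]
      change ((-(4 * Real.pi ^ 2 / 3) * η ^ 2 * c η : ℝ) : ℂ) - _ = _
      rw [← e2]
      push_cast
      ring
    rw [e, ← ofReal_norm, Complex.norm_real, ofReal_norm]
    simp only [paraMass]
    rw [ENNReal.tsum_mul_left]
    gcongr
    refine enorm_tsum_le_tsum_enorm.trans (ENNReal.tsum_le_tsum fun p => ?_)
    refine enorm_tsum_le_tsum_enorm.trans_eq ?_
    simp only [← ofReal_norm, Real.norm_eq_abs]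

/-- By the equation, `|û(η)| ≤ |(u²)^(η)|` at `η ≠ 0`, whose weighted sum is finite. -/
theorem memHdot_of_isConvolutionSolution {c : ℤ → ℝ} (h : IsConvolutionSolution c)
    {f : TorusDistribution} (hf : ∀ ξ, f.coeff ξ = c ξ) : f.MemHdot (-5) := by
  refine lt_of_le_of_lt (hdotNorm_le_tsum_freqWeight le_rfl fun η hη => ?_)
    (tsum_weight_lt_top h.summable_weight)
  gcongr
  have h3 : ∑' ξ, ‖c ξ * c (η - ξ)‖ₑ ≤ ∑' ξ, ENNReal.ofReal (|c ξ| * |c (η - ξ)|) :=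
    ENNReal.tsum_le_tsum fun ξ => by rw [← ofReal_norm, Real.norm_eq_abs, abs_mul]
  refine le_trans ?_ h3
  · refine le_trans ?_ enorm_tsum_le_tsum_enorm
    rw [(h.hasSum_mul η hη).tsum_eq, hf, ← ofReal_norm, ← ofReal_norm, Complex.norm_real]
    refine ENNReal.ofReal_le_ofReal ?_
    rw [norm_mul]
    refine le_mul_of_one_le_left (norm_nonneg _) ?_
    have h1 : (1 : ℝ) ≤ |(η : ℝ)| := by exact_mod_cast Int.one_le_abs hη
    have h2 := Real.pi_gt_three
    rw [norm_mul, norm_pow, norm_neg, Real.norm_of_nonneg (by positivity), Real.norm_eq_abs]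
    exact one_le_mul_of_one_le_of_one_le (by nlinarith) (one_le_pow₀ h1)

theorem isWeakParaproductSolution_of_isConvolutionSolution (hφ : IsLPProfile φ) {c : ℤ → ℝ}
    (h : IsConvolutionSolution c) {f : TorusDistribution} (hf : ∀ ξ, f.coeff ξ = c ξ) :
    IsWeakParaproductSolution φ f := by
  refine ⟨⟨-5, by norm_num, memHdot_of_isConvolutionSolution h hf⟩, -5, thirdSecondDeriv f hf,
    isParaproduct_thirdSecondDeriv hφ h hf, fun ψ hψ => ?_⟩
  have e : ∀ ξ : ℤ, f.coeff ξ * fourierCoeff (torusDeriv (torusDeriv (torusDeriv ψ))) (-ξ) =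
      3 * ((thirdSecondDeriv f hf).coeff ξ * fourierCoeff (torusDeriv ψ) (-ξ)) := by
    intro ξ
    rw [hψ.torusDeriv.torusDeriv.fourierCoeff_torusDeriv, hψ.torusDeriv.fourierCoeff_torusDeriv, hf]
    change _ = 3 * (((-(4 * Real.pi ^ 2 / 3) * ξ ^ 2 * c ξ : ℝ) : ℂ) * _)
    push_cast
    linear_combination (4 * Real.pi ^ 2 * ξ ^ 2 * c ξ * fourierCoeff (torusDeriv ψ) (-ξ) : ℂ) *
      Complex.I_sq
  simp only [TorusDistribution.pairing, e]
  rw [tsum_mul_left]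
  ring

end Paraproduct

/-- For every choice of the Littlewood-Paley profile `φ`, the flexibility result holds. -/
theorem theorem1p4 (φ : ℝ → ℝ) (hφ : IsLPProfile φ) :
    ∃ u : UnitAddCircle → ℝ,
      (∀ ε : ℝ, 0 < ε → ε < 1 →
        MemBesovInfty φ (-ε) (TorusDistribution.ofFun fun x => (u x : ℂ)) ∧
        MemLp u (ENNReal.ofReal (2 - ε)) volume) ∧
      ¬ MemLp u 2 volume ∧
      (∃ s₀ : ℝ, ∀ s : ℝ, s₀ ≤ s →
        ParaproductWellDefined φ (-s) (TorusDistribution.ofFun fun x => (u x : ℂ))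
          (TorusDistribution.ofFun fun x => (u x : ℂ))) ∧
      IsWeakParaproductSolution φ (TorusDistribution.ofFun fun x => (u x : ℂ)) := by
  obtain ⟨f, g, h⟩ := exists_isStageSequence
  obtain ⟨u, hLp, hu⟩ := h.exists_limit
  have hc := h.isConvolutionSolution
  have hf : ∀ ξ, (TorusDistribution.ofFun fun x => (u x : ℂ)).coeff ξ = limitCoeff f ξ := hu
  exact ⟨u, fun ε hε hε1 => ⟨memBesovInfty_of_sum_le_log hφ hf hc.sum_le_log hε hε1, hLp ε hε hε1⟩,
    not_memLp_two_of_not_summable hu h.not_summable_sq,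
    ⟨5, fun s hs => paraproductWellDefined_of_isConvolutionSolution hφ hc hf hs⟩,
    isWeakParaproductSolution_of_isConvolutionSolution hφ hc hf⟩
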